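/- **Setting.** Let $G$ be a finite simple graph on $\{0,\dots,N-1\}$ and $E=\{(a,b): a<b,\ \{a,b\}\in E(G)\}$. The relation $E$ is stored on disk as a TrieArray: the sorted array $\mathrm{val}_0$ of first components, the array $\mathrm{val}_1$ of their sorted lists of second components, concatenated, and the array $\mathrm{idx}_0$ of offsets into $\mathrm{val}_1$. Main memory holds $M$ words, a block holds $B$ words, and reading or writing one block costs one I/O. The triangle query is $T(x,y,z)\leftarrow E(x,y),E(x,z),E(y,z)$ with key order $x,y,z$. **Boxed Leapfrog Triejoin (boxed LFTJ).** Three of the $\lfloor M/B\rfloor$ memory blocks are kept as buffers; each of the $n=3$ variables (dimensions) gets a third (rounded down) of the others, plus what the preceding dimension left unused. At dimension $i$ one provisions the atoms whose first variable is $x_i$, and the earlier spilled atoms whose second variable is $x_i$, in rounds. Start with $l=-\infty$. In each round every such atom is *probed*: with its equal share of the memory of this dimension (a whole number of blocks) as a budget, one finds the maximal $h\ge l$ such that the slice of the atom in which its current attribute lies in $[l,h]$ fits; if already the slice with $[l,l]$ does not fit, the atom *spills*, $h$ is set to $l$, and the atom with first attribute fixed to $l$ is provisioned at the dimension of its second variable.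 With $h$ now the minimum over the atoms, the slices on $[l,h]$ of the atoms that do not spill are loaded, dimension $i+1$ is processed recursively, and one continues with $l:=h+1$ until $h=\infty$. When all three dimensions have an interval, in-memory Leapfrog Triejoin is run on the loaded slices in the box, and the output is streamed to disk through a one-block buffer. Positions in the arrays are carried along from round to round, and the upper bounds are located by binary search among the positions within reach of the budget. **Statement.** Assume $B\ge 1$ and $M\ge 60B$. For every $\delta>0$ there is a constant $C>0$, depending only on $\delta$, such that for all $G,M,B$ as above with $|E|\ge\delta M$ the following holds, where $K$ is the number of triangles of $G$. Boxed LFTJ applied to the triangle query outputs each triangle $(x,y,z)$, $x<y<z$, of $G$ exactly once and nothing else, never uses more than $M$ words of memory for slices and block buffers, and performs at most $$C\left(\frac{|E|^3}{M^2B}+\frac KB\right)$$ I/Os. If no spill occurs during the execution, it performs at most $$C\left(\frac{|E|^2}{MB}+\frac KB\right)$$ I/Os. -/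

import Mathlib

/-! Boxed Leapfrog Triejoin for full conjunctive queries whose atoms are binary, as an executable
procedure over relations stored on disk in blocks of `B` words, with a main memory of `M` words.
Every block transfer is counted.  Attribute values are natural numbers; the least value `0` plays the
role of minus infinity, and `⊤ : WithTop ℕ` that of plus infinity. -/

namespace BoxedLFTJ

/-- TrieArray of a binary relation: `val0` lists the values of the first column, and the children of
the value `val0[j]` are `val1[k]` for `idx0[j] ≤ k < idx0[j+1]`. -/
structure TrieArray where
  val0 : List ℕ
  idx0 : List ℕ
  val1 : List ℕ

/-- The values of the first column of `R`, in increasing order. -/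
def keys (R : Finset (ℕ × ℕ)) : List ℕ := (R.image Prod.fst).sort (· ≤ ·)

/-- The set `R_a` of all `b` with `(a, b) ∈ R`, in increasing order. -/
def children (R : Finset (ℕ × ℕ)) (a : ℕ) : List ℕ :=
  ((R.filter (fun p => p.1 = a)).image Prod.snd).sort (· ≤ ·)

/-- The TrieArray representation of a binary relation. -/
def TrieArray.ofRel (R : Finset (ℕ × ℕ)) : TrieArray where
  val0 := keys R
  idx0 := (List.range ((keys R).length + 1)).map fun j =>
    (((keys R).take j).map fun a => (children R a).length).sum
  val1 := (keys R).flatMap (children R)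

/-- A body atom `rel(x_fst, x_snd)`; variables are numbered from `0` in key order, and
`fst < snd`. -/
structure Atom where
  fst : ℕ
  snd : ℕ
  rel : TrieArray

/-- Number of disk blocks that meet the entries `s, …, e - 1` of an array. -/
def blockCount (B s e : ℕ) : ℕ := if s < e then (e - 1) / B + 1 - s / B else 0

/-- Binary search in external memory for the first position of `[lo, hi)` at which `P` fails (`hi` if
there is none), where evaluating `P` at a position reads the array entry at that position.  As soon as
at most `B` candidates are left, the (at most two) blocks that hold them are read and the search is
finished in memory.  The second component is the number of block reads. -/
def search (B : ℕ) (P : ℕ → Bool) (lo hi : ℕ) : ℕ × ℕ :=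
  if hi - lo ≤ B then
    (lo + ((List.range' lo (hi - lo)).takeWhile P).length, blockCount B lo hi)
  else
    let mid := (lo + hi) / 2
    if P mid then
      let r := search B P (mid + 1) hi
      (r.1, r.2 + 1)
    else
      let r := search B P lo mid
      (r.1, r.2 + 1)
termination_by hi - lo
decreasing_by all_goals omega

/-- An atom in the course of being provisioned.  If `pre = none`, the slices are taken at level 0
(ranges of first-column values, positions refer to `val0`); if `pre = some a`, the atom was spilled at
the value `a` and the slices are taken at level 1 (ranges of children of `a`, positions refer to
`val1`).  The entries at positions `cur, …, bound - 1` have not yet been consumed. -/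
structure Cursor where
  atom : Atom
  pre : Option ℕ
  cur : ℕ
  bound : ℕ

/-- A slice in main memory, identified with its set of tuples, of the atom over the variables
`x_fst`, `x_snd`. -/
structure Slice where
  fst : ℕ
  snd : ℕ
  tuples : List (ℕ × ℕ)

/-- What probing one atom reports: the end of the largest range of positions that fits into the
budget, the upper bound for the variable, whether the answer is SPILL, and the block reads. -/
structure Probe where
  fit : ℕ
  high : WithTop ℕ
  spill : Bool
  reads : ℕ

namespace Cursor

/-- The cursor over the whole atom. -/
def start (A : Atom) : Cursor := ⟨A, none, 0, A.rel.val0.length⟩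

/-- The value at position `j`. -/
def key (c : Cursor) (j : ℕ) : ℕ :=
  match c.pre with
  | none => c.atom.rel.val0.getD j 0
  | some _ => c.atom.rel.val1.getD j 0

/-- The entry `idx0[j]`. -/
def idx (c : Cursor) (j : ℕ) : ℕ := c.atom.rel.idx0.getD j 0

/-- Words occupied by the TrieArray slice of the positions `cur, …, q - 1`. -/
def words (c : Cursor) (q : ℕ) : ℕ :=
  match c.pre with
  | none => (q - c.cur) + (q - c.cur + 1) + (c.idx q - c.idx c.cur)
  | some _ => q - c.cur

/-- The slice of the positions `cur, …, q - 1`. -/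
def slice (c : Cursor) (q : ℕ) : Slice where
  fst := c.atom.fst
  snd := c.atom.snd
  tuples :=
    match c.pre with
    | none => (List.range' c.cur (q - c.cur)).flatMap fun j =>
        (List.range' (c.idx j) (c.idx (j + 1) - c.idx j)).map fun k =>
          (c.key j, c.atom.rel.val1.getD k 0)
    | some a => (List.range' c.cur (q - c.cur)).map fun k => (a, c.key k)

/-- The largest `q ≤ bound` such that the slice of the positions `cur, …, q - 1` has at most `w` words
(or `cur`), with the number of block reads.  At level 0 it is found by binary search for the upper
bound, each guess `q` being tested by following the pointer `idx0[q]`; more than `w` positions never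
fit, so guesses beyond `cur + w` are not made.  At level 1 no disk access is needed. -/
def fitEnd (c : Cursor) (B w : ℕ) : ℕ × ℕ :=
  match c.pre with
  | none =>
    let r := search B (fun q => decide (c.words q ≤ w)) (c.cur + 1) (min c.bound (c.cur + w) + 1)
    (r.1 - 1, r.2 + 1)
  | some _ => (min c.bound (c.cur + w), 0)

/-- Probing from the lower bound `l` with a budget of `w` words: the maximal `h ≥ l` such that the
slice from `l` to `h` fits, or SPILL if already the slice from `l` to `l` does not fit.  In the latter
case the upper bound is set to `l`. -/
def probe (c : Cursor) (B w l : ℕ) : Probe :=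
  let q := c.fitEnd B w
  if q.1 = c.bound then ⟨q.1, ⊤, false, q.2⟩
  else if c.key q.1 = l then ⟨q.1, (l : ℕ), true, q.2 + 1⟩
  else ⟨q.1, ((c.key q.1 - 1 : ℕ) : WithTop ℕ), false, q.2 + 1⟩

/-- The end of the range of positions with value at most `h`, given that positions from `q` on do not
belong to it, with the number of block reads. -/
def locate (c : Cursor) (B : ℕ) (h : WithTop ℕ) (q : ℕ) : ℕ × ℕ :=
  search B (fun j => decide ((c.key j : WithTop ℕ) ≤ h)) c.cur q

/-- Block reads for copying the slice of the positions `cur, …, q - 1` into main memory. -/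
def loadReads (c : Cursor) (B q : ℕ) : ℕ :=
  match c.pre with
  | none => blockCount B c.cur q + blockCount B c.cur (q + 1) + blockCount B (c.idx c.cur) (c.idx q)
  | some _ => blockCount B c.cur q

/-- The spilled atom, to be provisioned at the dimension of its second attribute: the children of the
value `a` at the current position. -/
def descend (c : Cursor) (a : ℕ) : Cursor := ⟨c.atom, some a, c.idx c.cur, c.idx (c.cur + 1)⟩

end Cursor

/-- The unary relations that Leapfrog Triejoin intersects to bind the next variable, when the values of
the previous variables are `t`. -/
def unaries (S : List Slice) (t : List ℕ) : List (List ℕ) :=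
  S.filterMap fun s =>
    if s.fst = t.length then some (s.tuples.map Prod.fst).dedup
    else if s.snd = t.length then
      some ((s.tuples.filter fun p => decide (p.1 = t.getD s.fst 0)).map Prod.snd)
    else none

/-- Their intersection. -/
def candidates (S : List Slice) (t : List ℕ) : List ℕ :=
  match unaries S t with
  | [] => []
  | u :: us => u.filter fun v => us.all fun u' => decide (v ∈ u')

/-- Leapfrog Triejoin in main memory, on slices, restricted to a box: bind the variables one after the
other to the values in the intersections, backtracking. -/
def lftj (S : List Slice) : List (ℕ × WithTop ℕ) → List ℕ → List (List ℕ)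
  | [], t => [t]
  | (l, h) :: box, t =>
    ((candidates S t).filter fun v => decide (l ≤ v ∧ (v : WithTop ℕ) ≤ h)).flatMap fun v =>
      lftj S box (t ++ [v])

/-- Outcome of a part of the execution: output tuples in order, number of input block reads, number of
spills, and peak memory consumption in blocks. -/
structure Result where
  out : List (List ℕ)
  reads : ℕ
  spills : ℕ
  peak : ℕ

/-- Outcome of two parts of the execution, one after the other. -/
def Result.seq (r s : Result) : Result :=
  ⟨r.out ++ s.out, r.reads + s.reads, r.spills + s.spills, max r.peak s.peak⟩

/-- The repeat-until loop of one dimension, from the lower bound `l` on: probe all atoms, each with an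
equal share of the `mem` blocks, take the smallest upper bound `h`, provision the atoms that do not
spill, call `body` (with `l`, `h`, the new slices, the blocks they use, and the spilled atoms), and
continue with the lower bound `h + 1` until `h` is infinite.  The first number bounds the number of
rounds. -/
def loop (B mem : ℕ) (body : ℕ → WithTop ℕ → List Slice → ℕ → List Cursor → Result) :
    ℕ → ℕ → List Cursor → Result
  | 0, _, _ => ⟨[], 0, 0, 0⟩
  | rounds + 1, l, cs =>
    let w := mem / cs.length * B
    let ps := cs.map fun c => (c, c.probe B w l)
    let h := (ps.map fun p => p.2.high).foldr min ⊤
    let spilled := ps.filter fun p => p.2.spill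
    let kept := (ps.filter fun p => !p.2.spill).map fun p => (p.1, p.1.locate B h p.2.fit)
    let cost : Result :=
      ⟨[], (ps.map fun p => p.2.reads).sum
          + (kept.map fun p => p.2.2 + p.1.loadReads B p.2.1).sum
          + 2 * spilled.length,
        spilled.length, 0⟩
    let r := cost.seq (body l h (kept.map fun p => p.1.slice p.2.1)
      ((kept.map fun p => p.1.words p.2.1 ⌈/⌉ B).sum)
      (spilled.map fun p => p.1.descend l))
    match h with
    | none => r
    | some h' =>
      let next := ps.map fun p =>
        { p.1 with cur := if p.2.spill then p.1.cur + 1 else (p.1.locate B h p.2.fit).1 }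
      r.seq (loop B mem body rounds (h' + 1) next)

/-- The recursive boxing procedure for `n` variables with values below `D`.  The first number is the
number of remaining dimensions, and `i` is the current one.  `pend` holds the atoms that were spilled
and are not yet provisioned; `slices` (occupying `used` blocks) and `box` are what the outer dimensions
have fixed.  Lower bounds increase strictly and stay below `D`, so that no loop has more than `D + 1`
rounds.  Apart from the slices, three blocks are in use: a buffer for the output and two for searching
and reading. -/
def boxUp (B D n memMax : ℕ) (atoms : List Atom) :
    ℕ → (i leftover : ℕ) → (pend : List Cursor) → (slices : List Slice) → (used : ℕ) →
      (box : List (ℕ × WithTop ℕ)) → Result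
  | 0, _, _, _, slices, used, box => ⟨lftj slices box [], 0, 0, used + 3⟩
  | k + 1, i, leftover, pend, slices, used, box =>
    let mem := memMax / n + leftover
    let cs := (atoms.filter fun A => decide (A.fst = i)).map Cursor.start
      ++ pend.filter fun c => decide (c.atom.snd = i)
    loop B mem
      (fun l h S u sp =>
        boxUp B D n memMax atoms k (i + 1) (mem - u)
          ((pend.filter fun c => !decide (c.atom.snd = i)) ++ sp)
          (slices ++ S) (used + u) (box ++ [(l, h)]))
      (D + 1) 0 cs

/-- Boxed Leapfrog Triejoin with `n` variables and main memory of `M` words. -/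
def run (M B D n : ℕ) (atoms : List Atom) : Result :=
  boxUp B D n (M / B - 3) atoms n 0 0 [] [] 0 []

/-- Total number of I/Os: the block reads, and the block writes for the output, which is streamed
through a buffer of one block (`n` words per tuple). -/
def Result.ios (r : Result) (B n : ℕ) : ℕ := r.reads + (n * r.out.length) ⌈/⌉ B

/-- The body `E(x,y), E(x,z), E(y,z)` of the triangle query, with key order `x, y, z`. -/
def triangleQuery (E : Finset (ℕ × ℕ)) : List Atom :=
  [⟨0, 1, TrieArray.ofRel E⟩, ⟨0, 2, TrieArray.ofRel E⟩, ⟨1, 2, TrieArray.ofRel E⟩]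

/-- The edge relation of the directed version of a graph: `(min a b, max a b)` for each edge. -/
def directedEdges {N : ℕ} (G : SimpleGraph (Fin N)) [DecidableRel G.Adj] : Finset (ℕ × ℕ) :=
  ((Finset.univ : Finset (Fin N × Fin N)).filter fun p => p.1 < p.2 ∧ G.Adj p.1 p.2).image
    fun p => ((p.1 : ℕ), (p.2 : ℕ))

/-- Boxed Leapfrog Triejoin applied to the triangle query on the graph `G`. -/
def triangleRun {N : ℕ} (G : SimpleGraph (Fin N)) [DecidableRel G.Adj] (M B : ℕ) : Result :=
  run M B N 3 (triangleQuery (directedEdges G))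

end BoxedLFTJ

namespace BoxedLFTJ

/-! ### Binary search and block counts -/

/-! Correctness. In one dimension the rounds cut the remaining values into consecutive intervals
`[l, h]`. For an assignment whose current coordinate lies in the interval, an atom holds iff its
loaded slice does, or, if it spilled, iff the child list of `l` does: a spill forces `h = l`, so
nothing but the value `l` is at stake. For larger coordinates the advanced cursor is equivalent to
the old one (`LoopInv.sat_round`, `LoopInv.sat_next`). Disjoint intervals make the outputs disjoint,
and induction over the dimensions reduces everything to in-memory Leapfrog Triejoin (`mem_lftj`,
`boxUp_out`).

Number of rounds. Let `w` be the budget of one atom. If an atom attains the finite minimum `h`, its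
slice together with the next position exceeds `w` words. That position is not consumed in this
round, so the remaining words need not drop by `w` at once. Hence the potential of a cursor is the
number of remaining words plus the number remaining once the value `l` is passed. It never
increases, and it loses at least `w` at the cursor that attains `h`
(`GoodAt.next_potential_add_le`). A dimension has at most three cursors, each with at most `3|E|`
words, and `w` is of order `M`, so there are at most `ρ = O(|E|/M)` rounds; the additive 1 for the
last round is absorbed by `δM ≤ |E|`.

Cost. A round reads at most 12 times the memory of its dimension, so `O(M/B)` blocks. Binary search
costs no more than loading, because its reads are bounded linearly in the window. Three nested
dimensions give `O(ρ³ · M/B)`, which is `|E|³/(M²B)`. No atom has the last variable first, so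
without spills the last dimension has no cursors, its only round is free, and `ρ²` remains. -/

theorem search_spec (B : ℕ) (P : ℕ → Bool) (lo hi : ℕ) (hle : lo ≤ hi) :
    lo ≤ (search B P lo hi).1 ∧ (search B P lo hi).1 ≤ hi ∧
      ((search B P lo hi).1 < hi → P (search B P lo hi).1 = false) ∧
      (lo < (search B P lo hi).1 → P ((search B P lo hi).1 - 1) = true) := by
  induction lo, hi using search.induct B P with
  | case1 lo hi hB =>
    rw [search, if_pos hB]
    set t := (List.range' lo (hi - lo)).takeWhile P with ht
    have hpre : t <+: List.range' lo (hi - lo) := List.takeWhile_prefix P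
    have hlen : t.length ≤ hi - lo := by simpa using hpre.length_le
    refine ⟨by simp, by simp only; omega, fun h => ?_, fun h => ?_⟩
    · simp only at h ⊢
      have hlt : t.length < (List.range' lo (hi - lo)).length := by simp; omega
      have := List.dropWhile_get_zero_not P (List.range' lo (hi - lo)) (by
        have h1 := congrArg List.length (List.takeWhile_append_dropWhile (p := P)
          (l := List.range' lo (hi - lo)))
        rw [List.length_append, ← ht] at h1
        omega)
      have h2 : (List.range' lo (hi - lo)).dropWhile P
          = (List.range' lo (hi - lo)).drop t.length := by
        have h1 := List.takeWhile_append_dropWhile (p := P) (l := List.range' lo (hi - lo))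
        conv_rhs => rw [← h1, ← ht]
        simp
      simp only [h2, List.get_eq_getElem, List.getElem_drop, List.getElem_range'] at this
      simpa using this
    · simp only at h ⊢
      have hpos : t.length - 1 < t.length := by omega
      have h1 : P t[t.length - 1] = true :=
        List.mem_takeWhile_imp (List.getElem_mem hpos)
      have h2 := hpre.getElem hpos
      rw [h2] at h1
      simp only [List.getElem_range'] at h1
      rwa [show lo + t.length - 1 = lo + 1 * (t.length - 1) by omega]
  | case2 lo hi hB mid hP ih =>
    rw [search, if_neg hB]
    have hP' : P ((lo + hi) / 2) = true := hP
    simp only [hP', if_true]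
    obtain ⟨h1, h2, h3, h4⟩ := ih (by omega)
    refine ⟨le_trans (by omega) h1, h2, h3, fun _ => ?_⟩
    rcases Nat.lt_or_ge (mid + 1) (search B P (mid + 1) hi).1 with h | h
    · exact h4 h
    · have : (search B P (mid + 1) hi).1 - 1 = mid := by omega
      change P ((search B P (mid + 1) hi).1 - 1) = true
      rw [this]; exact hP
  | case3 lo hi hB mid hP ih =>
    rw [search, if_neg hB]
    have hP' : ¬ P ((lo + hi) / 2) = true := hP
    simp only [hP']
    obtain ⟨h1, h2, h3, h4⟩ := ih (by omega)
    refine ⟨h1, le_trans h2 (by omega), fun _ => ?_, h4⟩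
    rcases Nat.lt_or_ge (search B P lo mid).1 mid with h | h
    · exact h3 h
    · have : (search B P lo mid).1 = mid := by omega
      change P (search B P lo mid).1 = false
      rw [this]; simpa using hP

/-- The range can stick out of whole blocks only at its two ends, whence the summand `2 * B`. -/
theorem blockCount_mul_le (B s e : ℕ) (hB : 0 < B) : B * blockCount B s e ≤ (e - s) + 2 * B := by
  unfold blockCount
  split_ifs with h
  · have h1 := Nat.div_mul_le_self (e - 1) B
    have h2 := Nat.lt_div_mul_add (a := s) hB
    have h3 : s / B ≤ (e - 1) / B := Nat.div_le_div_right (by omega)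
    obtain ⟨d, hd⟩ := Nat.exists_eq_add_of_le h3
    rw [hd] at h1 ⊢
    have : s / B + d + 1 - s / B = d + 1 := by omega
    rw [this]
    rw [Nat.add_mul] at h1
    rw [Nat.mul_add, Nat.mul_comm B d]
    omega
  · simp

theorem blockCount_le (B s e r : ℕ) (hB : 0 < B) (h : e - s ≤ r * B) :
    blockCount B s e ≤ r + 2 := by
  have := blockCount_mul_le B s e hB
  refine le_of_mul_le_mul_left (a := B) ?_ hB
  nlinarith

/-- Each guess halves a window of more than `B` candidates, so `2 * (hi - lo)` drops by more than
`B`, which pays for one read. The bound is linear instead of logarithmic, but it suffices: the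
windows are as long as the budget, and loading a slice may cost as much. -/
theorem search_reads_mul_le (B : ℕ) (P : ℕ → Bool) (lo hi : ℕ) (hB : 0 < B) :
    B * (search B P lo hi).2 ≤ 2 * (hi - lo) + 2 * B := by
  induction lo, hi using search.induct B P with
  | case1 lo hi h =>
    rw [search, if_pos h]
    have := blockCount_mul_le B lo hi hB
    simp only
    omega
  | case2 lo hi h mid hP ih =>
    rw [search, if_neg h]
    have hP' : P ((lo + hi) / 2) = true := hP
    simp only [hP', if_true]
    change B * ((search B P (mid + 1) hi).2 + 1) ≤ _
    have : 2 * (hi - (mid + 1)) ≤ hi - lo := by omega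
    rw [Nat.mul_add]
    omega
  | case3 lo hi h mid hP ih =>
    rw [search, if_neg h]
    have hP' : ¬ P ((lo + hi) / 2) = true := hP
    simp only [hP']
    change B * ((search B P lo mid).2 + 1) ≤ _
    have : 2 * (mid - lo) ≤ hi - lo := by omega
    rw [Nat.mul_add]
    omega

theorem search_reads_le (B : ℕ) (P : ℕ → Bool) (lo hi r : ℕ) (hB : 0 < B)
    (h : hi - lo ≤ r * B) : (search B P lo hi).2 ≤ 2 * r + 2 := by
  have := search_reads_mul_le B P lo hi hB
  refine le_of_mul_le_mul_left (a := B) ?_ hB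
  nlinarith

/-! ### Cursors -/

namespace Cursor

/-- The tuple `p` is stored below position `j`. -/
def Has (c : Cursor) (j : ℕ) (p : ℕ × ℕ) : Prop :=
  match c.pre with
  | none => p.1 = c.key j ∧
      ∃ k, c.idx j ≤ k ∧ k < c.idx (j + 1) ∧ p.2 = c.atom.rel.val1.getD k 0
  | some a => p.1 = a ∧ p.2 = c.key j

/-- The variable at which the cursor is provisioned. -/
def dim (c : Cursor) : ℕ :=
  match c.pre with
  | none => c.atom.fst
  | some _ => c.atom.snd

/-- The tuple `t` of values satisfies what remains of the atom. -/
def Sat (c : Cursor) (t : List ℕ) : Prop :=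
  (t.getD c.atom.fst 0, t.getD c.atom.snd 0) ∈ (c.slice c.bound).tuples

/-- A well-formed cursor whose remaining values lie between `l` and `D - 1`. -/
structure GoodAt (D l : ℕ) (c : Cursor) : Prop where
  le : c.cur ≤ c.bound
  mono : ∀ i j, c.cur ≤ i → i < j → j < c.bound → c.key i < c.key j
  low : ∀ j, c.cur ≤ j → j < c.bound → l ≤ c.key j
  top : ∀ j, c.cur ≤ j → j < c.bound → c.key j < D
  idx_le : c.pre = none → ∀ j, c.cur ≤ j → j < c.bound → c.idx j ≤ c.idx (j + 1)
  child_mono : c.pre = none → ∀ j, c.cur ≤ j → j < c.bound → ∀ i k, c.idx j ≤ i → i < k →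
    k < c.idx (j + 1) → c.atom.rel.val1.getD i 0 < c.atom.rel.val1.getD k 0
  child_top : c.pre = none → ∀ j, c.cur ≤ j → j < c.bound → ∀ k, c.idx j ≤ k →
    k < c.idx (j + 1) → c.atom.rel.val1.getD k 0 < D

theorem mem_slice (c : Cursor) (q : ℕ) (p : ℕ × ℕ) :
    p ∈ (c.slice q).tuples ↔ ∃ j, c.cur ≤ j ∧ j < q ∧ c.Has j p := by
  obtain ⟨A, pre, cur, bound⟩ := c
  obtain ⟨a, b⟩ := p
  cases pre with
  | none =>
    simp only [slice, Has, List.mem_flatMap, List.mem_map, List.mem_range'_1, Prod.mk.injEq]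
    constructor
    · rintro ⟨j, ⟨h1, h2⟩, k, ⟨h3, h4⟩, h5, h6⟩
      exact ⟨j, h1, by omega, h5.symm, k, h3, by omega, h6.symm⟩
    · rintro ⟨j, h1, h2, h5, k, h3, h4, h6⟩
      exact ⟨j, ⟨h1, by omega⟩, k, ⟨h3, by omega⟩, h5.symm, h6.symm⟩
  | some x =>
    simp only [slice, Has, List.mem_map, List.mem_range'_1, Prod.mk.injEq]
    constructor
    · rintro ⟨k, ⟨h1, h2⟩, h5, h6⟩
      exact ⟨k, h1, by omega, h5.symm, h6.symm⟩
    · rintro ⟨k, h1, h2, h5, h6⟩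
      exact ⟨k, ⟨h1, by omega⟩, h5.symm, h6.symm⟩

theorem Has.key_eq {c : Cursor} {j : ℕ} {t : List ℕ}
    (h : c.Has j (t.getD c.atom.fst 0, t.getD c.atom.snd 0)) : t.getD c.dim 0 = c.key j := by
  unfold Has at h
  unfold dim
  split at h
  · exact h.1
  · exact h.2

theorem GoodAt.mono' {D l : ℕ} {c : Cursor} (hc : c.GoodAt D l) {i j : ℕ} (hi : c.cur ≤ i)
    (hij : i ≤ j) (hj : j < c.bound) : c.key i ≤ c.key j := by
  rcases hij.eq_or_lt with rfl | h
  · exact le_rfl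
  · exact (hc.mono i j hi h hj).le

theorem GoodAt.idx_mono {D l : ℕ} {c : Cursor} (hc : c.GoodAt D l) (hp : c.pre = none) {i j : ℕ}
    (hi : c.cur ≤ i) (hij : i ≤ j) (hj : j ≤ c.bound) : c.idx i ≤ c.idx j := by
  induction j, hij using Nat.le_induction with
  | base => exact le_rfl
  | succ j hij ih => exact (ih (by omega)).trans (hc.idx_le hp j (by omega) (by omega))

theorem GoodAt.slice_nodup {D l : ℕ} {c : Cursor} (hc : c.GoodAt D l) {q : ℕ} (hq : q ≤ c.bound) :
    (c.slice q).tuples.Nodup := by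
  obtain ⟨A, pre, cur, bound⟩ := c
  cases pre with
  | none =>
    simp only [slice]
    rw [List.nodup_flatMap]
    refine ⟨fun j hj => ?_, ?_⟩
    · rw [List.mem_range'_1] at hj
      refine List.Nodup.map_on ?_ List.nodup_range'
      intro x hx y hy hxy
      rw [List.mem_range'_1] at hx hy
      simp only [Prod.mk.injEq, true_and] at hxy
      have hm := hc.child_mono rfl j hj.1 (by simp only at hq ⊢; omega)
      rcases lt_trichotomy x y with h | h | h
      · exact absurd hxy (hm x y hx.1 h (by omega)).ne
      · exact h
      · exact absurd hxy (hm y x hy.1 h (by omega)).ne'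
    · have := List.nodup_range' (s := cur) (n := q - cur) (step := 1)
      refine List.Pairwise.imp_of_mem ?_ this
      intro i j hi hj hij
      rw [List.mem_range'_1] at hi hj
      intro p hp hp'
      simp only [List.mem_map] at hp hp'
      obtain ⟨_, _, rfl⟩ := hp
      obtain ⟨_, _, h⟩ := hp'
      have h := congrArg Prod.fst h
      simp only at h
      rcases lt_or_gt_of_ne hij with h' | h'
      · exact absurd h (hc.mono i j hi.1 h' (by simp only at hq ⊢; omega)).ne'
      · exact absurd h (hc.mono j i hj.1 h' (by simp only at hq ⊢; omega)).ne
  | some a =>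
    simp only [slice]
    refine List.Nodup.map_on ?_ List.nodup_range'
    intro x hx y hy hxy
    rw [List.mem_range'_1] at hx hy
    simp only [Prod.mk.injEq, true_and] at hxy
    rcases lt_trichotomy x y with h | h | h
    · exact absurd hxy (hc.mono x y hx.1 h (by simp only at hq ⊢; omega)).ne
    · exact h
    · exact absurd hxy (hc.mono y x hy.1 h (by simp only at hq ⊢; omega)).ne'

theorem GoodAt.advance {D l l' r : ℕ} {c : Cursor} (hc : c.GoodAt D l) (h1 : c.cur ≤ r)
    (h2 : r ≤ c.bound) (h3 : ∀ j, r ≤ j → j < c.bound → l' ≤ c.key j) :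
    GoodAt D l' { c with cur := r } where
  le := h2
  mono i j hi hij hj := hc.mono i j (h1.trans hi) hij hj
  low j hj hj' := h3 j hj hj'
  top j hj hj' := hc.top j (h1.trans hj) hj'
  idx_le hp j hj hj' := hc.idx_le hp j (h1.trans hj) hj'
  child_mono hp j hj hj' := hc.child_mono hp j (h1.trans hj) hj'
  child_top hp j hj hj' := hc.child_top hp j (h1.trans hj) hj'

theorem GoodAt.descend {D l a : ℕ} {c : Cursor} (hc : c.GoodAt D l) (hp : c.pre = none)
    (hlt : c.cur < c.bound) : (c.descend a).GoodAt D 0 where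
  le := hc.idx_le hp _ le_rfl hlt
  mono i j hi hij hj := hc.child_mono hp _ le_rfl hlt i j hi hij hj
  low j hj hj' := Nat.zero_le _
  top j hj hj' := hc.child_top hp _ le_rfl hlt j hj hj'
  idx_le h := by cases h
  child_mono h := by cases h
  child_top h := by cases h

/-- Words needed for the remaining positions from `j` on. -/
def rest (c : Cursor) (j : ℕ) : ℕ :=
  match c.pre with
  | none => 2 * (c.bound - j) + (c.idx c.bound - c.idx j)
  | some _ => c.bound - j

theorem GoodAt.words_mono {D l : ℕ} {c : Cursor} (hc : c.GoodAt D l) {q r : ℕ} (h1 : c.cur ≤ q)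
    (h2 : q ≤ r) (h3 : r ≤ c.bound) : c.words q ≤ c.words r := by
  have := fun hp => hc.idx_mono hp h1 h2 h3
  unfold words
  split
  · rename_i hp
    have := this hp
    omega
  · omega

theorem GoodAt.rest_anti {D l : ℕ} {c : Cursor} (hc : c.GoodAt D l) {q r : ℕ} (h1 : c.cur ≤ q)
    (h2 : q ≤ r) (h3 : r ≤ c.bound) : c.rest r ≤ c.rest q := by
  have := fun hp => hc.idx_mono hp h1 h2 h3
  unfold rest
  split
  · rename_i hp
    have := this hp
    omega
  · omega

/-- The 1 is the closing offset that a level-0 slice stores in addition to one offset per position.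
It does no harm later: a slice that does not fit has at least `w + 1` words. -/
theorem GoodAt.rest_words {D l : ℕ} {c : Cursor} (hc : c.GoodAt D l) {q : ℕ} (h1 : c.cur ≤ q)
    (h3 : q ≤ c.bound) : c.rest q + c.words q ≤ c.rest c.cur + 1 := by
  have h := fun hp => hc.idx_mono hp h1 h3 le_rfl
  have h' := fun hp => hc.idx_mono hp le_rfl h1 h3
  unfold rest words
  cases hp : c.pre with
  | none =>
    have := h hp
    have := h' hp
    simp only
    omega
  | some a => simp only; omega

theorem sub_le_words (c : Cursor) (q : ℕ) : q - c.cur ≤ c.words q := by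
  unfold words
  split <;> omega

theorem words_cur_le (c : Cursor) : c.words c.cur ≤ 1 := by
  unfold words
  split <;> omega

/-- The search yields a crossing point: the slice up to it fits and the next one does not, which
needs no monotonicity of `words`. Since `1 ≤ w`, even the empty level-0 slice (one offset) fits, and
at level 1 one position always fits, so that level never spills. -/
theorem GoodAt.fitEnd_spec {D l : ℕ} {c : Cursor} (hc : c.GoodAt D l) (B w : ℕ) (hw : 1 ≤ w) :
    c.cur ≤ (c.fitEnd B w).1 ∧ (c.fitEnd B w).1 ≤ c.bound ∧ c.words (c.fitEnd B w).1 ≤ w ∧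
      ((c.fitEnd B w).1 < c.bound → w < c.words ((c.fitEnd B w).1 + 1)) ∧
      (c.pre ≠ none → (c.fitEnd B w).1 < c.bound → c.cur < (c.fitEnd B w).1) := by
  have hle := hc.le
  unfold fitEnd
  split
  · rename_i hp
    obtain ⟨h1, h2, h3, h4⟩ := search_spec B (fun q => decide (c.words q ≤ w)) (c.cur + 1)
      (min c.bound (c.cur + w) + 1) (by omega)
    simp only [decide_eq_true_eq, decide_eq_false_iff_not, not_le] at h3 h4 ⊢
    set r := (search B (fun q => decide (c.words q ≤ w)) (c.cur + 1)
      (min c.bound (c.cur + w) + 1)).1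
    refine ⟨by omega, by omega, ?_, fun h => ?_, fun h => absurd hp h⟩
    · rcases h1.eq_or_lt with h | h
      · rw [← h, Nat.add_sub_cancel]
        exact c.words_cur_le.trans hw
      · exact h4 h
    · rw [show r - 1 + 1 = r by omega]
      rcases h2.eq_or_lt with h' | h'
      -- The search ran to its end `cur + w + 1`: that many positions alone exceed `w` words.
      · have := c.sub_le_words r
        omega
      · exact h3 h'
  · rename_i a hp
    simp only [words, hp]
    omega

theorem fitEnd_reads_le (c : Cursor) (B s : ℕ) (hB : 0 < B) :
    (c.fitEnd B (s * B)).2 ≤ 2 * s + 3 := by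
  unfold fitEnd
  split
  · have := search_reads_le B (fun q => decide (c.words q ≤ s * B)) (c.cur + 1)
      (min c.bound (c.cur + s * B) + 1) s hB (by omega)
    simp only
    omega
  · simp

theorem probe_fit (c : Cursor) (B w l : ℕ) : (c.probe B w l).fit = (c.fitEnd B w).1 := by
  unfold probe
  simp only
  split_ifs <;> rfl

theorem probe_reads_le (c : Cursor) (B s l : ℕ) (hB : 0 < B) :
    (c.probe B (s * B) l).reads ≤ 2 * s + 4 := by
  have := c.fitEnd_reads_le B s hB
  unfold probe
  simp only
  split_ifs <;> simp only <;> omega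

theorem GoodAt.le_probe_high {D l : ℕ} {c : Cursor} (hc : c.GoodAt D l) (B w : ℕ) (hw : 1 ≤ w) :
    (l : WithTop ℕ) ≤ (c.probe B w l).high := by
  obtain ⟨h1, h2, -⟩ := hc.fitEnd_spec B w hw
  unfold probe
  simp only
  split_ifs with h h'
  · exact le_top
  · exact le_rfl
  · have := hc.low _ h1 (by omega)
    simp only
    exact_mod_cast (show l ≤ c.key (c.fitEnd B w).1 - 1 by omega)

/-- Keys increase strictly from a value at least `l`, so a first unfit position with key `l` can
only be `cur` itself. Its slice alone exceeds `w`, so passing this one position frees `w` words. -/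
theorem GoodAt.probe_spill {D l : ℕ} {c : Cursor} (hc : c.GoodAt D l) {B w : ℕ} (hw : 1 ≤ w)
    (hs : (c.probe B w l).spill = true) :
    c.pre = none ∧ c.cur < c.bound ∧ c.key c.cur = l ∧ (c.probe B w l).high = (l : ℕ) ∧
      w + c.rest (c.cur + 1) ≤ c.rest c.cur := by
  obtain ⟨h1, h2, h3, h4, h5⟩ := hc.fitEnd_spec B w hw
  unfold probe at hs ⊢
  simp only at hs ⊢
  split_ifs at hs ⊢ with h h'
  have hlt : (c.fitEnd B w).1 < c.bound := by omega
  have hcur : (c.fitEnd B w).1 = c.cur := by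
    by_contra hne
    have ha := hc.mono c.cur _ le_rfl (by omega) hlt
    have hb := hc.low c.cur le_rfl (by omega)
    omega
  have h4 := h4 hlt
  rw [hcur] at h4 hlt h'
  have := hc.rest_words (q := c.cur + 1) (by omega) (by omega)
  refine ⟨?_, hlt, h', rfl, by omega⟩
  by_contra hne
  have := h5 hne (by omega)
  omega

/-- The key at `fit` is at least `l` and different from `l`, hence positive, so the truncated
subtraction in `high` is exact. The third clause is the source of progress: the words drop by `w`
only past the position `fit`, which is not yet consumed. -/
theorem GoodAt.probe_keep {D l : ℕ} {c : Cursor} (hc : c.GoodAt D l) {B w : ℕ} (hw : 1 ≤ w)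
    (hs : (c.probe B w l).spill = false) :
    (∀ j, (c.probe B w l).fit ≤ j → j < c.bound → (c.probe B w l).high < (c.key j : ℕ)) ∧
    (∀ h : ℕ, (c.probe B w l).high = h → (c.probe B w l).fit < c.bound ∧
      c.key (c.probe B w l).fit = h + 1 ∧
      w + c.rest ((c.probe B w l).fit + 1) ≤ c.rest c.cur ∧
      (c.key c.cur = l → c.cur < (c.probe B w l).fit)) := by
  obtain ⟨h1, h2, h3, h4, h5⟩ := hc.fitEnd_spec B w hw
  unfold probe at hs ⊢
  simp only at hs ⊢
  split_ifs at hs ⊢ with h h'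
  · simp only
    refine ⟨fun j hj hj' => by omega, fun h h' => by cases h'⟩
  · simp only
    have hlt : (c.fitEnd B w).1 < c.bound := by omega
    have hlow := hc.low _ h1 hlt
    refine ⟨fun j hj hj' => ?_, fun x hx => ⟨hlt, ?_, ?_, fun hk => ?_⟩⟩
    · have := hc.mono' h1 hj hj'
      exact_mod_cast (show c.key (c.fitEnd B w).1 - 1 < c.key j by omega)
    · have : c.key (c.fitEnd B w).1 - 1 = x := by exact_mod_cast hx
      omega
    · have := hc.rest_words (q := (c.fitEnd B w).1 + 1) (by omega) (by omega)
      have := h4 hlt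
      omega
    · rcases h1.eq_or_lt with h6 | h6
      · rw [← h6] at h'
        exact absurd hk h'
      · exact h6

/-- Monotone keys turn the crossing point of the search into a description of all positions.
Stopping at `q` loses nothing, as every key from there on exceeds `h`. -/
theorem GoodAt.locate_spec {D l : ℕ} {c : Cursor} (hc : c.GoodAt D l) (B q : ℕ) (h : WithTop ℕ)
    (h1 : c.cur ≤ q) (h2 : q ≤ c.bound) (h3 : ∀ j, q ≤ j → j < c.bound → h < (c.key j : ℕ)) :
    c.cur ≤ (c.locate B h q).1 ∧ (c.locate B h q).1 ≤ q ∧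
      ∀ j, c.cur ≤ j → j < c.bound → (j < (c.locate B h q).1 ↔ (c.key j : WithTop ℕ) ≤ h) := by
  obtain ⟨a1, a2, a3, a4⟩ :=
    search_spec B (fun j => decide ((c.key j : WithTop ℕ) ≤ h)) c.cur q h1
  unfold locate
  set r := (search B (fun j => decide ((c.key j : WithTop ℕ) ≤ h)) c.cur q).1
  simp only [decide_eq_true_eq, decide_eq_false_iff_not, not_le] at a3 a4
  refine ⟨a1, a2, fun j hj hj' => ⟨fun hr => ?_, fun hk => ?_⟩⟩
  · have hm := hc.mono' hj (show j ≤ r - 1 by omega) (by omega)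
    exact le_trans (by exact_mod_cast hm) (a4 (by omega))
  · by_contra hr
    rcases a2.eq_or_lt with h' | h'
    · exact absurd hk (not_le.2 (h3 j (by omega) hj'))
    · have hm := hc.mono' a1 (show r ≤ j by omega) hj'
      have : (c.key r : WithTop ℕ) ≤ c.key j := by exact_mod_cast hm
      exact absurd (this.trans hk) (not_le.2 (a3 h'))

theorem locate_reads_le (c : Cursor) (B q s : ℕ) (h : WithTop ℕ) (hB : 0 < B)
    (hq : c.words q ≤ s * B) : (c.locate B h q).2 ≤ 2 * s + 2 :=
  search_reads_le _ _ _ _ _ hB ((c.sub_le_words q).trans hq)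

theorem loadReads_le (c : Cursor) (B q s : ℕ) (hB : 0 < B) (hq : c.words q ≤ s * B) :
    c.loadReads B q ≤ 3 * s + 6 := by
  unfold loadReads
  unfold words at hq
  split at hq
  · have h1 := blockCount_le B c.cur q s hB (by omega)
    have h2 := blockCount_le B c.cur (q + 1) s hB (by omega)
    have h3 := blockCount_le B (c.idx c.cur) (c.idx q) s hB (by omega)
    omega
  · have h1 := blockCount_le B c.cur q s hB (by omega)
    omega

end Cursor

/-! ### In-memory Leapfrog Triejoin -/

/-- The slice contains the pair that `t` assigns to its variables. -/
def Slice.Sat (s : Slice) (t : List ℕ) : Prop :=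
  (t.getD s.fst 0, t.getD s.snd 0) ∈ s.tuples

/-- The values `t` lie in the box. -/
def InBox (box : List (ℕ × WithTop ℕ)) (t : List ℕ) : Prop :=
  ∀ j p, box[j]? = some p → p.1 ≤ t.getD j 0 ∧ ((t.getD j 0 : ℕ) : WithTop ℕ) ≤ p.2

theorem inBox_concat (box : List (ℕ × WithTop ℕ)) (l : ℕ) (h : WithTop ℕ) (t : List ℕ) :
    InBox (box ++ [(l, h)]) t ↔ InBox box t ∧ l ≤ t.getD box.length 0 ∧
      ((t.getD box.length 0 : ℕ) : WithTop ℕ) ≤ h := by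
  constructor
  · intro H
    refine ⟨fun j p hj => H j p ?_, H box.length (l, h) (by simp)⟩
    have := (List.getElem?_eq_some_iff.1 hj).1
    rw [List.getElem?_append_left this, hj]
  · rintro ⟨H, h1⟩ j p hj
    rcases lt_trichotomy j box.length with hlt | rfl | hgt
    · rw [List.getElem?_append_left hlt] at hj
      exact H j p hj
    · simp only [List.getElem?_concat_length, Option.some.injEq] at hj
      subst hj
      exact h1
    · have := (List.getElem?_eq_some_iff.1 hj).1
      simp at this
      omega

/-- Some slice must mention the variable, because `candidates` returns no value for an empty family
of unary relations. -/
theorem mem_candidates {S : List Slice} {t : List ℕ} (v : ℕ)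
    (hcov : ∃ s ∈ S, s.fst = t.length ∨ s.snd = t.length) :
    v ∈ candidates S t ↔ ∀ s ∈ S,
      (s.fst = t.length → ∃ b, (v, b) ∈ s.tuples) ∧
      (s.fst ≠ t.length → s.snd = t.length → (t.getD s.fst 0, v) ∈ s.tuples) := by
  have key : (∀ u ∈ unaries S t, v ∈ u) ↔ ∀ s ∈ S,
      (s.fst = t.length → ∃ b, (v, b) ∈ s.tuples) ∧
      (s.fst ≠ t.length → s.snd = t.length → (t.getD s.fst 0, v) ∈ s.tuples) := by
    simp only [unaries, List.mem_filterMap, forall_exists_index, and_imp]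
    constructor
    · intro H s hs
      constructor
      · intro h
        have := H _ s hs (if_pos h)
        simpa using this
      · intro h h'
        have := H _ s hs (by rw [if_neg h, if_pos h'])
        simpa using this
    · intro H u s hs hu
      split_ifs at hu with h h'
      · cases hu
        simpa using (H s hs).1 h
      · cases hu
        simpa using (H s hs).2 h h'
  rw [← key]
  have hne : unaries S t ≠ [] := by
    obtain ⟨s, hs, h⟩ := hcov
    intro he
    simp only [unaries, List.filterMap_eq_nil_iff] at he
    have := he s hs
    split_ifs at this with h1 h2
    tauto
  unfold candidates
  split
  · contradiction
  · rename_i u us heq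
    simp [heq]

/-- First columns are deduplicated explicitly; a second column is read off below one fixed first
value, where `Prod.snd` is injective. -/
theorem candidates_nodup (S : List Slice) (t : List ℕ) (hS : ∀ s ∈ S, s.tuples.Nodup) :
    (candidates S t).Nodup := by
  unfold candidates
  split
  · exact List.nodup_nil
  · rename_i u us heq
    refine List.Nodup.filter _ ?_
    have hu : u ∈ unaries S t := by simp [heq]
    simp only [unaries, List.mem_filterMap] at hu
    obtain ⟨s, hs, hu⟩ := hu
    split_ifs at hu with h h'
    · cases hu
      exact List.nodup_dedup _
    · cases hu
      refine List.Nodup.map_on ?_ ((hS s hs).filter _)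
      rintro ⟨a, b⟩ hx ⟨a', b'⟩ hy h
      simp only [List.mem_filter, decide_eq_true_eq] at hx hy
      simp only at h
      rw [Prod.mk.injEq]
      exact ⟨hx.2.trans hy.2.symm, h⟩

theorem lftj_prefix (S : List Slice) (box : List (ℕ × WithTop ℕ)) (t t' : List ℕ)
    (h : t' ∈ lftj S box t) : t <+: t' := by
  induction box generalizing t with
  | nil =>
    simp only [lftj, List.mem_singleton] at h
    exact h ▸ List.prefix_rfl
  | cons p box ih =>
    simp only [lftj, List.mem_flatMap] at h
    obtain ⟨v, -, h⟩ := h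
    exact (List.prefix_append _ _).trans (ih _ h)

theorem lftj_nodup (S : List Slice) (box : List (ℕ × WithTop ℕ)) (t : List ℕ)
    (hS : ∀ s ∈ S, s.tuples.Nodup) : (lftj S box t).Nodup := by
  induction box generalizing t with
  | nil => simp [lftj]
  | cons p box ih =>
    simp only [lftj]
    rw [List.nodup_flatMap]
    refine ⟨fun v _ => ih _, ?_⟩
    refine List.Pairwise.imp ?_ ((candidates_nodup S t hS).filter _)
    intro v v' hne t' h h'
    have h1 := lftj_prefix _ _ _ _ h
    have h2 := lftj_prefix _ _ _ _ h'
    have h3 := h1.getElem (i := t.length) (by simp)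
    have h4 := h2.getElem (i := t.length) (by simp)
    simp at h3 h4
    exact hne (h3.trans h4.symm)

theorem getD_eq_of_prefix {t t' : List ℕ} (h : t <+: t') {j : ℕ} (hj : j < t.length) :
    t.getD j 0 = t'.getD j 0 := by
  have := h.length_le
  rw [List.getD_eq_getElem _ _ hj, List.getD_eq_getElem _ _ (by omega), h.getElem hj]

/-- A slice is fully tested when its second variable is bound, and `fst < snd` ensures that the
first one is then known. The earlier test at the first variable only prunes, since it follows from
the later one. Slices with both variables already in `t` are therefore left out of the claim. -/
theorem mem_lftj (S : List Slice) (box : List (ℕ × WithTop ℕ)) (t t' : List ℕ)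
    (hshape : ∀ s ∈ S, s.fst < s.snd ∧ s.snd < t.length + box.length)
    (hcov : ∀ j, t.length ≤ j → j < t.length + box.length → ∃ s ∈ S, s.fst = j ∨ s.snd = j) :
    t' ∈ lftj S box t ↔ t <+: t' ∧ t'.length = t.length + box.length ∧
      (∀ j p, box[j]? = some p → p.1 ≤ t'.getD (t.length + j) 0 ∧
        ((t'.getD (t.length + j) 0 : ℕ) : WithTop ℕ) ≤ p.2) ∧
      ∀ s ∈ S, t.length ≤ s.snd → s.Sat t' := by
  induction box generalizing t with
  | nil =>
    simp only [lftj, List.mem_singleton, List.length_nil, Nat.add_zero]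
    constructor
    · rintro rfl
      refine ⟨List.prefix_rfl, rfl, by simp, fun s hs h => ?_⟩
      have := (hshape s hs).2
      simp at this
      omega
    · rintro ⟨h1, h2, -⟩
      exact (h1.eq_of_length h2.symm).symm
  | cons p box ih =>
    obtain ⟨l, h⟩ := p
    simp only [List.length_cons] at hshape hcov ⊢
    have ih' := fun v => ih (t ++ [v])
      (fun s hs => ⟨(hshape s hs).1, by
        have := (hshape s hs).2
        simp only [List.length_append, List.length_singleton]; omega⟩)
      (fun j h1 h2 => hcov j (by simp at h1; omega) (by simp at h2; omega))
    have hc := fun v => mem_candidates (S := S) (t := t) v (hcov t.length le_rfl (by omega))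
    simp only [lftj, List.mem_flatMap, List.mem_filter, decide_eq_true_eq, ih', hc,
      List.length_append, List.length_singleton]
    constructor
    · rintro ⟨v, ⟨hv, hl, hh⟩, h1, h2, h3, h4⟩
      have hp : t <+: t' := (List.prefix_append _ _).trans h1
      have hvt : t'.getD t.length 0 = v := by
        rw [← getD_eq_of_prefix h1 (by simp)]
        simp
      refine ⟨hp, by omega, fun j p hj => ?_, fun s hs hle => ?_⟩
      · cases j with
        | zero =>
          simp at hj
          subst hj
          rw [Nat.add_zero, hvt]
          exact ⟨hl, hh⟩
        | succ j =>
          have := h3 j p (by simpa using hj)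
          rwa [show t.length + (j + 1) = t.length + 1 + j by omega]
      · rcases hle.eq_or_lt with he | hlt
        · have hf := (hshape s hs).1
          have := (hv s hs).2 (by omega) he.symm
          unfold Slice.Sat
          rw [← he, hvt, ← getD_eq_of_prefix hp (by omega)]
          exact this
        · exact h4 s hs (by omega)
    · rintro ⟨h1, h2, h3, h4⟩
      have hlt : t.length < t'.length := by omega
      refine ⟨t'.getD t.length 0, ⟨fun s hs => ⟨fun hf => ?_, fun hf hsn => ?_⟩, ?_, ?_⟩,
        ?_, by omega, ?_, ?_⟩
      · have := h4 s hs (by have := (hshape s hs).1; omega)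
        unfold Slice.Sat at this
        rw [hf] at this
        exact ⟨_, this⟩
      · have := h4 s hs hsn.ge
        unfold Slice.Sat at this
        have hfs := (hshape s hs).1
        rw [hsn, ← getD_eq_of_prefix h1 (by omega)] at this
        exact this
      · exact (h3 0 (l, h) (by simp)).1
      · exact (h3 0 (l, h) (by simp)).2
      · obtain ⟨r, rfl⟩ := h1
        cases r with
        | nil => simp at hlt
        | cons x r => simp
      · intro j p hj
        have := h3 (j + 1) p (by simpa using hj)
        rwa [show t.length + (j + 1) = t.length + 1 + j by omega] at this
      · intro s hs hle
        exact h4 s hs (by omega)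

/-! ### One round of a dimension -/

namespace Cursor

/-- The end of the positions with value at most `h`, for an atom that does not spill. -/
def keptEnd (B w l : ℕ) (h : WithTop ℕ) (c : Cursor) : ℕ :=
  (c.locate B h (c.probe B w l).fit).1

/-- The cursor after the round with bounds `l` and `h`. -/
def next (B w l : ℕ) (h : WithTop ℕ) (c : Cursor) : Cursor :=
  { c with cur := if (c.probe B w l).spill then c.cur + 1 else c.keptEnd B w l h }

/-- An upper bound for `rest` after the positions with value `l`. -/
def restAfter (l : ℕ) (c : Cursor) : ℕ :=
  if c.cur < c.bound ∧ c.key c.cur = l then c.rest (c.cur + 1) else c.rest c.cur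

/-- Potential of a cursor at the lower bound `l`. -/
def potential (l : ℕ) (c : Cursor) : ℕ := c.rest c.cur + c.restAfter l

variable {D l : ℕ} {c : Cursor}

theorem GoodAt.restAfter_le (hc : c.GoodAt D l) : c.restAfter l ≤ c.rest c.cur := by
  unfold restAfter
  split_ifs with h
  · exact hc.rest_anti le_rfl (by omega) (by omega)
  · exact le_rfl

theorem GoodAt.potential_le (hc : c.GoodAt D l) : c.potential l ≤ 2 * c.rest c.cur := by
  have := hc.restAfter_le
  unfold potential
  omega

theorem GoodAt.keptEnd_spec (hc : c.GoodAt D l) {B w : ℕ} (hw : 1 ≤ w) {h : WithTop ℕ}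
    (hh : h ≤ (c.probe B w l).high) (hs : (c.probe B w l).spill = false) :
    c.cur ≤ c.keptEnd B w l h ∧ c.keptEnd B w l h ≤ (c.probe B w l).fit ∧
      c.keptEnd B w l h ≤ c.bound ∧ c.words (c.keptEnd B w l h) ≤ w ∧
      ∀ j, c.cur ≤ j → j < c.bound → (j < c.keptEnd B w l h ↔ (c.key j : WithTop ℕ) ≤ h) := by
  obtain ⟨h1, h2, h3, -⟩ := hc.fitEnd_spec B w hw
  rw [← c.probe_fit B w l] at h1 h2 h3
  obtain ⟨a1, a2, a3⟩ := hc.locate_spec B (c.probe B w l).fit h h1 h2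
    (fun j hj hj' => hh.trans_lt ((hc.probe_keep hw hs).1 j hj hj'))
  exact ⟨a1, a2, a2.trans h2, (hc.words_mono a1 a2 h2).trans h3, a3⟩

theorem GoodAt.sat_slice (hc : c.GoodAt D l) {B w : ℕ} (hw : 1 ≤ w) {h : WithTop ℕ}
    (hh : h ≤ (c.probe B w l).high) (hs : (c.probe B w l).spill = false) {t : List ℕ}
    (ht : (t.getD c.dim 0 : WithTop ℕ) ≤ h) :
    (c.slice (c.keptEnd B w l h)).Sat t ↔ c.Sat t := by
  obtain ⟨-, -, h3, -, h5⟩ := hc.keptEnd_spec hw hh hs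
  change (t.getD c.atom.fst 0, t.getD c.atom.snd 0) ∈ _ ↔ _
  unfold Sat
  simp only [mem_slice]
  constructor
  · rintro ⟨j, hj, hj', H⟩
    exact ⟨j, hj, by omega, H⟩
  · rintro ⟨j, hj, hj', H⟩
    exact ⟨j, hj, (h5 j hj hj').2 (H.key_eq ▸ ht), H⟩

theorem GoodAt.sat_descend (hc : c.GoodAt D l) {B w : ℕ} (hw : 1 ≤ w)
    (hs : (c.probe B w l).spill = true) {t : List ℕ} (ht : t.getD c.dim 0 = l) :
    (c.descend l).Sat t ↔ c.Sat t := by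
  obtain ⟨hp, hlt, hk, -⟩ := hc.probe_spill hw hs
  unfold Sat
  simp only [mem_slice]
  have hd : t.getD c.atom.fst 0 = l := by
    rw [← ht]; simp only [dim, hp]
  constructor
  · rintro ⟨k, hk1, hk2, H⟩
    refine ⟨c.cur, le_rfl, hlt, ?_⟩
    unfold Has
    simp only [hp]
    exact ⟨by rw [hk, hd], k, hk1, hk2, H.2⟩
  · rintro ⟨j, hj, hj', H⟩
    have hkj : c.key j = l := by rw [← H.key_eq, ht]
    have hjc : j = c.cur := by
      by_contra hne
      have := hc.mono c.cur j le_rfl (by omega) hj'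
      omega
    subst hjc
    unfold Has at H
    simp only [hp] at H
    obtain ⟨-, k, h1, h2, h3⟩ := H
    exact ⟨k, h1, h2, hd, h3⟩

theorem GoodAt.sat_next (hc : c.GoodAt D l) {B w : ℕ} (hw : 1 ≤ w) {h : WithTop ℕ}
    (hh : h ≤ (c.probe B w l).high) (hl : (l : WithTop ℕ) ≤ h) {t : List ℕ}
    (ht : h < (t.getD c.dim 0 : ℕ)) : (c.next B w l h).Sat t ↔ c.Sat t := by
  have main : (c.next B w l h).Sat t ↔ ∃ j, (c.next B w l h).cur ≤ j ∧ j < c.bound ∧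
      c.Has j (t.getD c.atom.fst 0, t.getD c.atom.snd 0) := by
    unfold Sat
    rw [mem_slice]
    rfl
  rw [main]
  unfold Sat
  rw [mem_slice]
  unfold next
  cases hs : (c.probe B w l).spill with
  | true =>
    obtain ⟨hp, hlt, hk, -⟩ := hc.probe_spill hw hs
    simp only [if_true]
    constructor
    · rintro ⟨j, hj, hj', H⟩
      exact ⟨j, by omega, hj', H⟩
    · rintro ⟨j, hj, hj', H⟩
      refine ⟨j, ?_, hj', H⟩
      rcases hj.eq_or_lt with rfl | h'
      · rw [H.key_eq, hk] at ht
        exact absurd hl (not_le.2 ht)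
      · exact h'
  | false =>
    obtain ⟨h1, -, -, -, h5⟩ := hc.keptEnd_spec hw hh hs
    simp only [Bool.false_eq_true, if_false]
    constructor
    · rintro ⟨j, hj, hj', H⟩
      exact ⟨j, by omega, hj', H⟩
    · rintro ⟨j, hj, hj', H⟩
      refine ⟨j, ?_, hj', H⟩
      by_contra hlt
      have := (h5 j hj hj').1 (by omega)
      rw [← H.key_eq] at this
      exact absurd this (not_le.2 ht)

theorem GoodAt.cur_le_next (hc : c.GoodAt D l) {B w : ℕ} (hw : 1 ≤ w) {h : WithTop ℕ}
    (hh : h ≤ (c.probe B w l).high) :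
    c.cur ≤ (c.next B w l h).cur ∧ (c.next B w l h).cur ≤ c.bound := by
  unfold next
  cases hs : (c.probe B w l).spill with
  | true =>
    obtain ⟨hp, hlt, hk, -⟩ := hc.probe_spill hw hs
    simp only [if_true]
    omega
  | false =>
    obtain ⟨h1, -, h3, -⟩ := hc.keptEnd_spec hw hh hs
    exact ⟨h1, h3⟩

/-- A spilled cursor advances by one position, which is enough because its upper bound, and hence
`h`, is at most `l`. -/
theorem GoodAt.next_good (hc : c.GoodAt D l) {B w : ℕ} (hw : 1 ≤ w) {h : ℕ}
    (hh : (h : WithTop ℕ) ≤ (c.probe B w l).high) : (c.next B w l h).GoodAt D (h + 1) := by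
  obtain ⟨h1, h2⟩ := hc.cur_le_next hw hh
  refine hc.advance h1 h2 fun j hj hj' => ?_
  have hcj := h1.trans hj
  cases hs : (c.probe B w l).spill with
  | true =>
    obtain ⟨hp, hlt, hk, hi, -⟩ := hc.probe_spill hw hs
    rw [hi] at hh
    have hh : h ≤ l := by exact_mod_cast hh
    simp only [hs, if_true] at hj
    have := hc.mono c.cur j le_rfl (by omega) hj'
    omega
  | false =>
    obtain ⟨-, -, -, -, h5⟩ := hc.keptEnd_spec hw hh hs
    simp only [hs, Bool.false_eq_true, if_false] at hj
    have := (h5 j hcj hj').not.1 (by omega)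
    have : ¬ c.key j ≤ h := fun hle => this (by exact_mod_cast hle)
    omega

/-- Since `l ≤ h`, a position with value `l` is consumed in any case, so the new remaining words are
at most the old `restAfter`. This gives the chain new `restAfter` ≤ new `rest` ≤ old `restAfter` ≤
old `rest`. -/
theorem GoodAt.next_potential_le (hc : c.GoodAt D l) {B w : ℕ} (hw : 1 ≤ w) {h : ℕ}
    (hh : (h : WithTop ℕ) ≤ (c.probe B w l).high) (hl : l ≤ h) :
    (c.next B w l h).potential (h + 1) ≤ c.potential l := by
  have hg := hc.next_good hw hh
  obtain ⟨h1, h2⟩ := hc.cur_le_next hw hh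
  have a1 := hg.restAfter_le
  have a2 : (c.next B w l h).rest (c.next B w l h).cur ≤ c.restAfter l := by
    change c.rest (c.next B w l h).cur ≤ _
    unfold restAfter
    split_ifs with hk
    · refine hc.rest_anti (by omega) ?_ h2
      unfold next
      cases hs : (c.probe B w l).spill with
      | true => simp
      | false =>
        obtain ⟨-, -, -, -, h5⟩ := hc.keptEnd_spec hw hh hs
        simp only [Bool.false_eq_true, if_false]
        exact (h5 c.cur le_rfl hk.1).2 (by exact_mod_cast hk.2.le.trans hl)
    · exact hc.rest_anti le_rfl h1 h2
  have a3 := hc.restAfter_le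
  unfold potential
  omega

/-- If the atom is kept, its first unfit position carries the value `h + 1`, the next lower bound.
So the new `restAfter` already skips it and is at most the old `rest` minus `w`, while the new
`rest` is at most the old `restAfter`. If it spills, both new summands are bounded by the words
after the spilled position. -/
theorem GoodAt.next_potential_add_le (hc : c.GoodAt D l) {B w : ℕ} (hw : 1 ≤ w) {h : ℕ}
    (hh : (c.probe B w l).high = h) :
    (c.next B w l h).potential (h + 1) + w ≤ c.potential l := by
  have hg := hc.next_good hw hh.ge
  cases hs : (c.probe B w l).spill with
  | true =>
    obtain ⟨hp, hlt, hk, hi, hr⟩ := hc.probe_spill hw hs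
    have hcur : (c.next B w l h).cur = c.cur + 1 := by simp [next, hs]
    have h1 : (c.next B w l h).rest (c.next B w l h).cur = c.rest (c.cur + 1) := by
      rw [hcur]; rfl
    have h2 := hg.potential_le
    have h3 : c.restAfter l = c.rest (c.cur + 1) := if_pos ⟨hlt, hk⟩
    unfold potential at h2 ⊢
    omega
  | false =>
    obtain ⟨h1, h2, h3, -, h5⟩ := hc.keptEnd_spec hw hh.ge hs
    obtain ⟨b1, b2, b3, b4⟩ := (hc.probe_keep hw hs).2 h hh
    -- The minimum is this cursor's own bound and its key at `fit` is `h + 1`, so it consumes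
    -- everything that fits.
    have hend : c.keptEnd B w l h = (c.probe B w l).fit := by
      refine le_antisymm h2 ?_
      by_contra hlt
      have a1 := (h5 _ h1 (by omega)).not.1 (lt_irrefl _)
      have a2 := hc.mono _ _ h1 (not_le.1 hlt) b1
      exact a1 (by exact_mod_cast (show c.key (c.keptEnd B w l h) ≤ h by omega))
    have hcur : (c.next B w l h).cur = (c.probe B w l).fit := by simp [next, hs, hend]
    have c1 : (c.next B w l h).rest (c.next B w l h).cur = c.rest (c.probe B w l).fit := by
      rw [hcur]; rfl
    have c2 : (c.next B w l h).restAfter (h + 1) = c.rest ((c.probe B w l).fit + 1) := by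
      unfold restAfter
      rw [if_pos]
      · rw [hcur]; rfl
      · rw [hcur]
        exact ⟨b1, b2⟩
    have c3 : c.rest (c.probe B w l).fit ≤ c.restAfter l := by
      unfold restAfter
      split_ifs with hk
      · exact hc.rest_anti (by omega) (b4 hk.2) b1.le
      · exact hc.rest_anti le_rfl (by omega) b1.le
    unfold potential
    omega

/-- This shows that the fuel `D + 1` of the loop never runs out: the next lower bound is at most
`D`. -/
theorem GoodAt.lt_of_high (hc : c.GoodAt D l) {B w : ℕ} (hw : 1 ≤ w) {h : ℕ}
    (hh : (c.probe B w l).high = h) : h < D := by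
  cases hs : (c.probe B w l).spill with
  | true =>
    obtain ⟨hp, hlt, hk, hi, hr⟩ := hc.probe_spill hw hs
    have := hc.top _ le_rfl hlt
    rw [hi] at hh
    have : l = h := by exact_mod_cast hh
    omega
  | false =>
    obtain ⟨b1, b2, -, -⟩ := (hc.probe_keep hw hs).2 h hh
    obtain ⟨h1, -⟩ := hc.fitEnd_spec B w hw
    rw [← c.probe_fit B w l] at h1
    have := hc.top _ h1 b1
    omega

theorem GoodAt.rest_descend_le (hc : c.GoodAt D l) (hp : c.pre = none) (hlt : c.cur < c.bound) :
    (c.descend l).rest (c.descend l).cur ≤ c.rest c.cur := by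
  change c.idx (c.cur + 1) - c.idx c.cur ≤ _
  have := hc.idx_mono hp (show c.cur ≤ c.cur + 1 by omega) hlt le_rfl
  unfold rest
  simp only [hp]
  omega

end Cursor

/-- The upper bound of the round. -/
def roundHigh (B w l : ℕ) (cs : List Cursor) : WithTop ℕ :=
  (cs.map fun c => (c.probe B w l).high).foldr min ⊤

/-- The slices that the round loads. -/
def roundSlices (B w l : ℕ) (h : WithTop ℕ) (cs : List Cursor) : List Slice :=
  (cs.filter fun c => !(c.probe B w l).spill).map fun c => c.slice (c.keptEnd B w l h)

/-- The blocks these slices occupy. -/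
def roundUsed (B w l : ℕ) (h : WithTop ℕ) (cs : List Cursor) : ℕ :=
  ((cs.filter fun c => !(c.probe B w l).spill).map fun c =>
    c.words (c.keptEnd B w l h) ⌈/⌉ B).sum

/-- The atoms that spill in the round. -/
def roundSpilled (B w l : ℕ) (cs : List Cursor) : List Cursor :=
  (cs.filter fun c => (c.probe B w l).spill).map fun c => c.descend l

/-- The block reads of the round. -/
def roundReads (B w l : ℕ) (h : WithTop ℕ) (cs : List Cursor) : ℕ :=
  (cs.map fun c => (c.probe B w l).reads).sum
    + ((cs.filter fun c => !(c.probe B w l).spill).map fun c =>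
        (c.locate B h (c.probe B w l).fit).2 + c.loadReads B (c.keptEnd B w l h)).sum
    + 2 * (roundSpilled B w l cs).length

/-- The outcome of one round. -/
def roundResult (B w : ℕ) (body : ℕ → WithTop ℕ → List Slice → ℕ → List Cursor → Result)
    (l : ℕ) (cs : List Cursor) : Result :=
  let h := roundHigh B w l cs
  (⟨[], roundReads B w l h cs, (roundSpilled B w l cs).length, 0⟩ : Result).seq
    (body l h (roundSlices B w l h cs) (roundUsed B w l h cs) (roundSpilled B w l cs))

theorem loop_succ (B mem : ℕ) (body : ℕ → WithTop ℕ → List Slice → ℕ → List Cursor → Result)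
    (k l : ℕ) (cs : List Cursor) :
    loop B mem body (k + 1) l cs =
      match roundHigh B (mem / cs.length * B) l cs with
      | none => roundResult B (mem / cs.length * B) body l cs
      | some h' => (roundResult B (mem / cs.length * B) body l cs).seq
          (loop B mem body k (h' + 1) (cs.map (Cursor.next B (mem / cs.length * B) l
            (roundHigh B (mem / cs.length * B) l cs)))) := by
  rw [loop]
  unfold roundResult roundReads roundSpilled roundUsed roundSlices roundHigh Cursor.next
    Cursor.keptEnd
  simp only [List.map_map, List.filter_map, List.length_map, Function.comp_def]

theorem foldr_min_le {L : List (WithTop ℕ)} {x : WithTop ℕ} (h : x ∈ L) : L.foldr min ⊤ ≤ x := by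
  induction L with
  | nil => simp at h
  | cons y L ih =>
    rcases List.mem_cons.1 h with rfl | h
    · exact min_le_left _ _
    · exact (min_le_right _ _).trans (ih h)

theorem le_foldr_min {L : List (WithTop ℕ)} {x : WithTop ℕ} (h : ∀ y ∈ L, x ≤ y) :
    x ≤ L.foldr min ⊤ := by
  induction L with
  | nil => exact le_top
  | cons y L ih =>
    exact le_min (h y (by simp)) (ih fun z hz => h z (by simp [hz]))

theorem foldr_min_mem {L : List (WithTop ℕ)} (h : L.foldr min ⊤ ≠ ⊤) : L.foldr min ⊤ ∈ L := by
  induction L with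
  | nil => simp at h
  | cons y L ih =>
    simp only [List.foldr_cons] at h ⊢
    rcases min_choice y (L.foldr min ⊤) with h' | h'
    · rw [h']; simp
    · rw [h'] at h ⊢
      exact List.mem_cons_of_mem _ (ih h)

theorem roundHigh_le {B w l : ℕ} {cs : List Cursor} {c : Cursor} (hc : c ∈ cs) :
    roundHigh B w l cs ≤ (c.probe B w l).high :=
  foldr_min_le (List.mem_map.2 ⟨c, hc, rfl⟩)

theorem exists_high_eq {B w l h : ℕ} {cs : List Cursor} (hh : roundHigh B w l cs = h) :
    ∃ c ∈ cs, (c.probe B w l).high = h := by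
  have : roundHigh B w l cs ∈ cs.map fun c => (c.probe B w l).high :=
    foldr_min_mem (by unfold roundHigh at hh; rw [hh]; exact WithTop.coe_ne_top)
  rw [hh, List.mem_map] at this
  exact this

theorem sum_map_le {α : Type*} {L : List α} {f : α → ℕ} {b : ℕ} (h : ∀ a ∈ L, f a ≤ b) :
    (L.map f).sum ≤ L.length * b := by
  have := List.sum_le_card_nsmul (L.map f) b (by simpa using h)
  simpa using this

/-- What holds for the cursors of dimension `i` at the lower bound `l`. -/
structure LoopInv (D T i l : ℕ) (L : List Atom) (cs : List Cursor) : Prop where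
  atoms : cs.map Cursor.atom = L
  good : ∀ c ∈ cs, c.GoodAt D l
  dim : ∀ c ∈ cs, c.dim = i
  rest : ∀ c ∈ cs, c.rest c.cur ≤ T

/-- What a round guarantees to the next dimension. -/
structure RoundFacts (D T i mem : ℕ) (L : List Atom) (S : List Slice) (u : ℕ)
    (sp : List Cursor) : Prop where
  nodup : ∀ s ∈ S, s.tuples.Nodup
  used : u ≤ mem
  good : ∀ c ∈ sp, c.GoodAt D 0
  rest : ∀ c ∈ sp, c.rest c.cur ≤ T
  slice_atom : ∀ s ∈ S, ∃ A ∈ L, A.fst = s.fst ∧ A.snd = s.snd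
  spilled_atom : ∀ c ∈ sp, c.atom ∈ L ∧ c.atom.fst = i ∧ c.pre ≠ none
  cover : ∀ A ∈ L, (∃ s ∈ S, s.fst = A.fst ∧ s.snd = A.snd) ∨ ∃ c ∈ sp, c.atom = A
  length : sp.length ≤ L.length

section

variable {B D T i l mem w : ℕ} {L : List Atom} {cs : List Cursor}

theorem LoopInv.le_roundHigh (H : LoopInv D T i l L cs) (hw : 1 ≤ w) :
    (l : WithTop ℕ) ≤ roundHigh B w l cs := by
  refine le_foldr_min fun y hy => ?_
  obtain ⟨c, hc, rfl⟩ := List.mem_map.1 hy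
  exact (H.good c hc).le_probe_high B w hw

theorem LoopInv.next (H : LoopInv D T i l L cs) (hw : 1 ≤ w) {h : ℕ}
    (hh : roundHigh B w l cs = h) :
    LoopInv D T i (h + 1) L (cs.map (Cursor.next B w l h)) where
  atoms := by
    rw [← H.atoms, List.map_map]
    rfl
  good c hc := by
    obtain ⟨c, hc', rfl⟩ := List.mem_map.1 hc
    exact (H.good c hc').next_good hw (hh ▸ roundHigh_le hc')
  dim c hc := by
    obtain ⟨c, hc', rfl⟩ := List.mem_map.1 hc
    exact H.dim c hc'
  rest c hc := by
    obtain ⟨c, hc', rfl⟩ := List.mem_map.1 hc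
    obtain ⟨h1, h2⟩ := (H.good c hc').cur_le_next hw (hh ▸ roundHigh_le hc')
    exact ((H.good c hc').rest_anti le_rfl h1 h2).trans (H.rest c hc')

theorem LoopInv.facts (H : LoopInv D T i l L cs) (hB : 0 < B) (hw : 1 ≤ mem / cs.length * B) :
    RoundFacts D T i mem L
      (roundSlices B (mem / cs.length * B) l (roundHigh B (mem / cs.length * B) l cs) cs)
      (roundUsed B (mem / cs.length * B) l (roundHigh B (mem / cs.length * B) l cs) cs)
      (roundSpilled B (mem / cs.length * B) l cs) := by
  set w := mem / cs.length * B with hwdef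
  set h := roundHigh B w l cs
  have hkept : ∀ c ∈ cs.filter (fun c => !(c.probe B w l).spill), c ∈ cs ∧
      (c.probe B w l).spill = false := by
    intro c hc
    simpa using List.mem_filter.1 hc
  have hsp : ∀ c ∈ cs.filter (fun c => (c.probe B w l).spill), c ∈ cs ∧
      (c.probe B w l).spill = true := by
    intro c hc
    simpa using List.mem_filter.1 hc
  refine ⟨?_, ?_, ?_, ?_, ?_, ?_, ?_, ?_⟩
  · intro s hs
    obtain ⟨c, hc, rfl⟩ := List.mem_map.1 hs
    obtain ⟨hc, hs⟩ := hkept c hc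
    exact (H.good c hc).slice_nodup
      ((H.good c hc).keptEnd_spec hw (roundHigh_le hc) hs).2.2.1
  -- Every kept slice fits into one share, which is a whole number of blocks, so rounding its size
  -- up to blocks stays within the share.
  · have h1 : roundUsed B w l h cs ≤
        (cs.filter fun c => !(c.probe B w l).spill).length * (mem / cs.length) := by
      unfold roundUsed
      refine sum_map_le fun c hc => ?_
      obtain ⟨hc, hs⟩ := hkept c hc
      rw [ceilDiv_le_iff_le_mul hB, mul_comm]
      exact ((H.good c hc).keptEnd_spec hw (roundHigh_le hc) hs).2.2.2.1
    exact h1.trans ((Nat.mul_le_mul_right _ (List.length_filter_le _ _)).trans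
      (Nat.mul_div_le _ _))
  · intro c hc
    obtain ⟨c, hc', rfl⟩ := List.mem_map.1 hc
    obtain ⟨hc, hs⟩ := hsp c hc'
    obtain ⟨h1, h2, -⟩ := (H.good c hc).probe_spill hw hs
    exact (H.good c hc).descend h1 h2
  · intro c hc
    obtain ⟨c, hc', rfl⟩ := List.mem_map.1 hc
    obtain ⟨hc, hs⟩ := hsp c hc'
    obtain ⟨h1, h2, -⟩ := (H.good c hc).probe_spill hw hs
    exact ((H.good c hc).rest_descend_le h1 h2).trans (H.rest c hc)
  · intro s hs
    obtain ⟨c, hc, rfl⟩ := List.mem_map.1 hs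
    exact ⟨c.atom, H.atoms ▸ List.mem_map_of_mem (hkept c hc).1, rfl, rfl⟩
  · intro c hc
    obtain ⟨c, hc', rfl⟩ := List.mem_map.1 hc
    obtain ⟨hc, hs⟩ := hsp c hc'
    obtain ⟨h1, h2, -⟩ := (H.good c hc).probe_spill hw hs
    have hmem : c.atom ∈ L := H.atoms ▸ List.mem_map_of_mem hc
    refine ⟨hmem, ?_, by simp [Cursor.descend]⟩
    rw [← H.dim c hc]
    simp [Cursor.descend, Cursor.dim, h1]
  · intro A hA
    rw [← H.atoms] at hA
    obtain ⟨c, hc, rfl⟩ := List.mem_map.1 hA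
    cases hs : (c.probe B w l).spill with
    | true =>
      exact Or.inr ⟨c.descend l, List.mem_map_of_mem (List.mem_filter.2 ⟨hc, hs⟩), rfl⟩
    | false =>
      exact Or.inl ⟨c.slice (c.keptEnd B w l h), List.mem_map.2
        ⟨c, List.mem_filter.2 ⟨hc, by simp [hs]⟩, rfl⟩, rfl, rfl⟩
  · unfold roundSpilled
    rw [List.length_map, ← H.atoms, List.length_map]
    exact List.length_filter_le _ _

/-- The bounds on coordinate `i` transfer the equivalences for single cursors. If a cursor spills,
the minimum is at most `l`, which pins the coordinate to `l`. -/
theorem LoopInv.sat_round (H : LoopInv D T i l L cs) (hw : 1 ≤ w) {t : List ℕ}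
    (h1 : l ≤ t.getD i 0) (h2 : ((t.getD i 0 : ℕ) : WithTop ℕ) ≤ roundHigh B w l cs) :
    ((∀ s ∈ roundSlices B w l (roundHigh B w l cs) cs, s.Sat t) ∧
      ∀ c ∈ roundSpilled B w l cs, c.Sat t) ↔ ∀ c ∈ cs, c.Sat t := by
  have hk : ∀ c ∈ cs, (c.probe B w l).spill = false →
      ((c.slice (c.keptEnd B w l (roundHigh B w l cs))).Sat t ↔ c.Sat t) := fun c hc hs =>
    (H.good c hc).sat_slice hw (roundHigh_le hc) hs (by rw [H.dim c hc]; exact h2)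
  have hd : ∀ c ∈ cs, (c.probe B w l).spill = true → ((c.descend l).Sat t ↔ c.Sat t) := by
    intro c hc hs
    refine (H.good c hc).sat_descend hw hs ?_
    rw [H.dim c hc]
    obtain ⟨-, -, -, hi, -⟩ := (H.good c hc).probe_spill hw hs
    have h3 := h2.trans (roundHigh_le hc)
    rw [hi] at h3
    have : t.getD i 0 ≤ l := by exact_mod_cast h3
    omega
  constructor
  · rintro ⟨a, b⟩ c hc
    cases hs : (c.probe B w l).spill with
    | true =>
      exact (hd c hc hs).1 (b _ (List.mem_map_of_mem (List.mem_filter.2 ⟨hc, hs⟩)))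
    | false =>
      exact (hk c hc hs).1 (a _ (List.mem_map.2 ⟨c, List.mem_filter.2 ⟨hc, by simp [hs]⟩, rfl⟩))
  · intro a
    constructor
    · intro s hs
      obtain ⟨c, hc, rfl⟩ := List.mem_map.1 hs
      obtain ⟨hc, hs⟩ := List.mem_filter.1 hc
      exact (hk c hc (by simpa using hs)).2 (a c hc)
    · intro s hs
      obtain ⟨c, hc, rfl⟩ := List.mem_map.1 hs
      obtain ⟨hc, hs⟩ := List.mem_filter.1 hc
      exact (hd c hc (by simpa using hs)).2 (a c hc)

theorem LoopInv.sat_next (H : LoopInv D T i l L cs) (hw : 1 ≤ w) {h : ℕ}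
    (hh : roundHigh B w l cs = h) {t : List ℕ} (ht : h < t.getD i 0) :
    (∀ c ∈ cs.map (Cursor.next B w l h), c.Sat t) ↔ ∀ c ∈ cs, c.Sat t := by
  simp only [List.forall_mem_map]
  refine forall₂_congr fun c hc => (H.good c hc).sat_next hw (hh ▸ roundHigh_le hc)
    (hh ▸ H.le_roundHigh hw) ?_
  rw [H.dim c hc]
  exact_mod_cast ht

theorem LoopInv.lt (H : LoopInv D T i l L cs) (hw : 1 ≤ w) {h : ℕ}
    (hh : roundHigh B w l cs = h) : h < D := by
  obtain ⟨c, hc, hi⟩ := exists_high_eq hh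
  exact (H.good c hc).lt_of_high hw hi

theorem sum_map_add_le {α : Type*} {L : List α} {f g : α → ℕ} {w : ℕ}
    (hle : ∀ a ∈ L, f a ≤ g a) {a : α} (ha : a ∈ L) (hlt : f a + w ≤ g a) :
    (L.map f).sum + w ≤ (L.map g).sum := by
  induction L with
  | nil => simp at ha
  | cons b L ih =>
    simp only [List.map_cons, List.sum_cons]
    have hb := hle b (by simp)
    rcases List.mem_cons.1 ha with rfl | ha
    · have := List.sum_le_sum (l := L) (f := f) (g := g) fun a ha => hle a (by simp [ha])
      omega
    · have := ih (fun a ha => hle a (by simp [ha])) ha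
      omega

theorem LoopInv.potential_next (H : LoopInv D T i l L cs) (hw : 1 ≤ w) {h : ℕ}
    (hh : roundHigh B w l cs = h) :
    ((cs.map (Cursor.next B w l h)).map (Cursor.potential (h + 1))).sum + w ≤
      (cs.map (Cursor.potential l)).sum := by
  have hl : l ≤ h := by
    have := H.le_roundHigh (B := B) hw
    rw [hh] at this
    exact_mod_cast this
  obtain ⟨c, hc, hi⟩ := exists_high_eq hh
  rw [List.map_map]
  exact sum_map_add_le
    (fun a ha => (H.good a ha).next_potential_le hw (hh ▸ roundHigh_le ha) hl) hc
    ((H.good c hc).next_potential_add_le hw hi)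

theorem LoopInv.potential_le (H : LoopInv D T i l L cs) :
    (cs.map (Cursor.potential l)).sum ≤ cs.length * (2 * T) := by
  refine sum_map_le fun c hc => ?_
  exact (H.good c hc).potential_le.trans (Nat.mul_le_mul_left _ (H.rest c hc))

/-- Per cursor: `2s + 4` for the probe, `2s + 2` for locating `h`, `3s + 6` for loading, 2 for a
spill. The sum `7s + 14` is at most `12s` once `3 ≤ s`. -/
theorem LoopInv.reads_le (H : LoopInv D T i l L cs) (hB : 0 < B) {s : ℕ} (hs : 3 ≤ s) :
    roundReads B (s * B) l (roundHigh B (s * B) l cs) cs ≤ cs.length * (12 * s) := by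
  have hw : 1 ≤ s * B := by nlinarith
  have h1 : (cs.map fun c => (c.probe B (s * B) l).reads).sum ≤ cs.length * (2 * s + 4) := by
    refine sum_map_le fun c hc => ?_
    exact c.probe_reads_le B s l hB
  have h2 : ((cs.filter fun c => !(c.probe B (s * B) l).spill).map fun c =>
        (c.locate B (roundHigh B (s * B) l cs) (c.probe B (s * B) l).fit).2
          + c.loadReads B (c.keptEnd B (s * B) l (roundHigh B (s * B) l cs))).sum
      ≤ cs.length * (5 * s + 8) := by
    refine le_trans ?_ (Nat.mul_le_mul_right _ (List.length_filter_le
      (fun c : Cursor => !(c.probe B (s * B) l).spill) cs))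
    refine sum_map_le fun c hc => ?_
    obtain ⟨hc, hsp⟩ := List.mem_filter.1 hc
    have hfit := ((H.good c hc).fitEnd_spec B (s * B) hw).2.2.1
    rw [← c.probe_fit B (s * B) l] at hfit
    have a1 := c.locate_reads_le B _ s (roundHigh B (s * B) l cs) hB hfit
    have a2 := c.loadReads_le B _ s hB
      ((H.good c hc).keptEnd_spec hw (roundHigh_le hc) (by simpa using hsp)).2.2.2.1
    omega
  have h3 : (roundSpilled B (s * B) l cs).length ≤ cs.length := by
    unfold roundSpilled
    rw [List.length_map]
    exact List.length_filter_le _ _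
  unfold roundReads
  have : cs.length * 3 ≤ cs.length * s := Nat.mul_le_mul_left _ hs
  nlinarith

end

/-! ### The loop of one dimension -/

section

variable {B D T i l mem : ℕ} {L : List Atom} {cs : List Cursor}
  {body : ℕ → WithTop ℕ → List Slice → ℕ → List Cursor → Result}

/-- The empty minimum is `⊤`, so a dimension without cursors has a single round without reads. It is
treated apart throughout, since the share `mem / 0` is 0 and the budget would vanish. -/
theorem loop_nil (k : ℕ) :
    loop B mem body (k + 1) l [] = (⟨[], 0, 0, 0⟩ : Result).seq (body l ⊤ [] 0 []) := by
  rw [loop_succ]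
  rfl

theorem RoundFacts.nil : RoundFacts D T i mem [] [] 0 [] := by
  constructor <;> simp

theorem one_le_share (hB : 0 < B) (hL : L ≠ []) (hmem : L.length ≤ mem) :
    1 ≤ mem / L.length * B :=
  Nat.mul_pos (Nat.div_pos hmem (List.length_pos_iff.2 hL)) hB

theorem LoopInv.length_eq (H : LoopInv D T i l L cs) : cs.length = L.length := by
  rw [← H.atoms, List.length_map]

/-- `Q` collects the conditions that this dimension does not affect. The rounds split coordinate `i`
at `h`: smaller or equal values come from the current round, larger ones from the rest of the loop.
This also gives disjointness. -/
theorem loop_out {Q : List ℕ → Prop} (hB : 0 < B) (hmem : L.length ≤ mem)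
    (hbody : ∀ l h S u sp, RoundFacts D T i mem L S u sp →
      (body l h S u sp).out.Nodup ∧ ∀ t, t ∈ (body l h S u sp).out ↔ Q t ∧ l ≤ t.getD i 0 ∧
        ((t.getD i 0 : ℕ) : WithTop ℕ) ≤ h ∧ (∀ s ∈ S, s.Sat t) ∧ ∀ c ∈ sp, c.Sat t)
    (k : ℕ) (H : LoopInv D T i l L cs) (hk : D + 1 ≤ l + k) (hl : l ≤ D) :
    (loop B mem body k l cs).out.Nodup ∧ ∀ t, t ∈ (loop B mem body k l cs).out ↔
      Q t ∧ l ≤ t.getD i 0 ∧ ∀ c ∈ cs, c.Sat t := by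
  by_cases hL : L = []
  · have hcs : cs = [] := List.length_eq_zero_iff.1 (by rw [H.length_eq, hL]; rfl)
    subst hcs hL
    obtain ⟨k, rfl⟩ : ∃ k', k = k' + 1 := ⟨k - 1, by omega⟩
    rw [loop_nil]
    simpa [Result.seq] using hbody l ⊤ [] 0 [] RoundFacts.nil
  induction k generalizing l cs with
  | zero => omega
  | succ k ih =>
    have hw : 1 ≤ mem / cs.length * B := by rw [H.length_eq]; exact one_le_share hB hL hmem
    rw [loop_succ]
    obtain ⟨b1, b2⟩ := hbody l (roundHigh B (mem / cs.length * B) l cs) _ _ _ (H.facts hB hw)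
    have hsat := fun t => H.sat_round (B := B) (t := t) hw
    set w := mem / cs.length * B
    have hr : (roundResult B w body l cs).out = (body l (roundHigh B w l cs)
        (roundSlices B w l (roundHigh B w l cs) cs) (roundUsed B w l (roundHigh B w l cs) cs)
        (roundSpilled B w l cs)).out := by
      simp [roundResult, Result.seq]
    have hr' : ∀ t, t ∈ (roundResult B w body l cs).out ↔ Q t ∧ l ≤ t.getD i 0 ∧
        ((t.getD i 0 : ℕ) : WithTop ℕ) ≤ roundHigh B w l cs ∧ ∀ c ∈ cs, c.Sat t := by
      intro t
      rw [hr, b2]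
      constructor
      · rintro ⟨a1, a2, a3, a4⟩
        exact ⟨a1, a2, a3, (hsat t a2 a3).1 a4⟩
      · rintro ⟨a1, a2, a3, a4⟩
        exact ⟨a1, a2, a3, (hsat t a2 a3).2 a4⟩
    rw [← hr] at b1
    cases hh : roundHigh B w l cs with
    | top =>
      refine ⟨b1, fun t => ?_⟩
      change t ∈ (roundResult B w body l cs).out ↔ _
      rw [hr', hh]
      simp
    | coe h =>
      change (Result.seq _ (loop B mem body k (h + 1) (cs.map (Cursor.next B w l h)))).out.Nodup ∧
        ∀ t, t ∈ (Result.seq _ (loop B mem body k (h + 1) (cs.map (Cursor.next B w l h)))).out ↔ _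
      have hlh : l ≤ h := by
        have : (l : WithTop ℕ) ≤ ((h : ℕ) : WithTop ℕ) :=
          (H.le_roundHigh (B := B) hw).trans hh.le
        exact_mod_cast this
      have hD := H.lt hw hh
      obtain ⟨c1, c2⟩ := ih (H.next hw hh) (by omega) (by omega)
      simp only [Result.seq]
      have hr'' : ∀ t, t ∈ (roundResult B w body l cs).out ↔ Q t ∧ l ≤ t.getD i 0 ∧
        t.getD i 0 ≤ h ∧ ∀ c ∈ cs, c.Sat t := by
        intro t
        rw [hr', hh]
        simp only [Nat.cast_withTop, WithTop.coe_le_coe]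
      refine ⟨List.nodup_append'.2 ⟨b1, c1, fun t ht ht' => ?_⟩, fun t => ?_⟩
      · have h1 := ((hr'' t).1 ht).2.2.1
        have h2 := ((c2 t).1 ht').2.1
        omega
      · rw [List.mem_append, hr'', c2]
        have hn := fun ht => H.sat_next (t := t) hw hh ht
        constructor
        · rintro (⟨a1, a2, a3, a4⟩ | ⟨a1, a2, a3⟩)
          · exact ⟨a1, a2, a4⟩
          · exact ⟨a1, by omega, (hn (by omega)).1 a3⟩
        · rintro ⟨a1, a2, a3⟩
          rcases Nat.lt_or_ge h (t.getD i 0) with h' | h'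
          · exact Or.inr ⟨a1, h', (hn h').2 a3⟩
          · exact Or.inl ⟨a1, a2, h', a3⟩

theorem loop_peak {X : ℕ} (hB : 0 < B) (hmem : L.length ≤ mem)
    (hbody : ∀ l h S u sp, RoundFacts D T i mem L S u sp → (body l h S u sp).peak ≤ X)
    (k : ℕ) (H : LoopInv D T i l L cs) : (loop B mem body k l cs).peak ≤ X := by
  by_cases hL : L = []
  · have hcs : cs = [] := List.length_eq_zero_iff.1 (by rw [H.length_eq, hL]; rfl)
    subst hcs hL
    cases k with
    | zero => exact Nat.zero_le _
    | succ k =>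
      rw [loop_nil]
      simpa [Result.seq] using hbody l ⊤ [] 0 [] RoundFacts.nil
  induction k generalizing l cs with
  | zero => exact Nat.zero_le _
  | succ k ih =>
    have hw : 1 ≤ mem / cs.length * B := by rw [H.length_eq]; exact one_le_share hB hL hmem
    rw [loop_succ]
    have b1 := hbody l (roundHigh B (mem / cs.length * B) l cs) _ _ _ (H.facts hB hw)
    set w := mem / cs.length * B
    have hr : (roundResult B w body l cs).peak ≤ X := by
      simpa [roundResult, Result.seq] using b1
    cases hh : roundHigh B w l cs with
    | top => exact hr
    | coe h => exact max_le hr (ih (H.next hw hh))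

/-- Each non-final round is paid by a potential drop of `s * B`, and the final one by the extra
summand `s * B`. The proposition `Z` serves both I/O bounds: with `Z` false nothing is assumed about
spills, with `Z` true the absence of spills is passed to every round. -/
theorem loop_reads {X : ℝ} {Z : Prop} {s : ℕ} (hX : 0 ≤ X) (hB : 0 < B)
    (hs : mem / L.length = s) (hs3 : 3 ≤ s)
    (hbody : ∀ l h S u sp, RoundFacts D T i mem L S u sp →
      (Z → sp = [] ∧ (body l h S u sp).spills = 0) → ((body l h S u sp).reads : ℝ) ≤ X)
    (k : ℕ) (H : LoopInv D T i l L cs) (hZ : Z → (loop B mem body k l cs).spills = 0) :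
    ((s * B : ℕ) : ℝ) * (loop B mem body k l cs).reads ≤
      (((cs.map (Cursor.potential l)).sum + s * B : ℕ) : ℝ) * (12 * mem + X) := by
  have hw : 1 ≤ s * B := by nlinarith
  induction k generalizing l cs with
  | zero =>
    simp only [loop, Nat.cast_zero, mul_zero]
    positivity
  | succ k ih =>
    have hcs := H.length_eq
    rw [loop_succ, hcs, hs] at hZ ⊢
    have hfacts := H.facts (mem := mem) hB (by rw [hcs, hs]; exact hw)
    rw [hcs, hs] at hfacts
    have b1 := hbody l (roundHigh B (s * B) l cs) _ _ _ hfacts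
    have b2 := H.reads_le hB hs3
    have hmem : cs.length * s ≤ mem := by rw [hcs, ← hs]; exact Nat.mul_div_le _ _
    have hr : (Z → (roundResult B (s * B) body l cs).spills = 0) →
        ((roundResult B (s * B) body l cs).reads : ℝ) ≤ 12 * mem + X := by
      intro hz
      simp only [roundResult, Result.seq, Nat.add_eq_zero_iff, List.length_eq_zero_iff] at hz ⊢
      have b1 := b1 hz
      have b3 : roundReads B (s * B) l (roundHigh B (s * B) l cs) cs ≤ 12 * mem := by nlinarith
      have b3 : (roundReads B (s * B) l (roundHigh B (s * B) l cs) cs : ℝ) ≤ 12 * mem := by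
        exact_mod_cast b3
      push_cast
      linarith
    cases hh : roundHigh B (s * B) l cs with
    | top =>
      rw [hh] at hZ
      have := hr hZ
      change ((s * B : ℕ) : ℝ) * ((roundResult B (s * B) body l cs).reads : ℝ) ≤ _
      refine mul_le_mul ?_ this (by positivity) (by positivity)
      exact_mod_cast Nat.le_add_left _ _
    | coe h =>
      rw [hh] at hZ
      have hZ : Z → (roundResult B (s * B) body l cs).spills + (loop B mem body k (h + 1)
          (cs.map (Cursor.next B (s * B) l h))).spills = 0 := hZ
      have hr := hr fun z => by have := hZ z; omega
      have ih := ih (H.next hw hh) fun z => by have := hZ z; omega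
      have hp := H.potential_next hw hh
      change ((s * B : ℕ) : ℝ) * (((roundResult B (s * B) body l cs).reads + (loop B mem body k
        (h + 1) (cs.map (Cursor.next B (s * B) l h))).reads : ℕ) : ℝ) ≤ _
      have hp' : ((((cs.map (Cursor.next B (s * B) l h)).map
        (Cursor.potential (h + 1))).sum + s * B : ℕ) : ℝ) ≤ (cs.map (Cursor.potential l)).sum := by
        exact_mod_cast hp
      have h1 := mul_le_mul_of_nonneg_left hr (Nat.cast_nonneg (α := ℝ) (s * B))
      have h2 := mul_le_mul_of_nonneg_right hp' (show (0 : ℝ) ≤ 12 * mem + X by positivity)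
      rw [Nat.cast_add, mul_add, Nat.cast_add, add_mul]
      linarith

end

/-! ### The boxing recursion -/

/-- What holds when dimension `i` is entered. -/
structure BoxInv (D T n Y : ℕ) (atoms : List Atom) (i : ℕ) (pend : List Cursor)
    (slices : List Slice) : Prop where
  atom_lt : ∀ A ∈ atoms, A.fst < A.snd ∧ A.snd < n
  atom_good : ∀ A ∈ atoms, (Cursor.start A).GoodAt D 0
  atom_rest : ∀ A ∈ atoms, (Cursor.start A).rest (Cursor.start A).cur ≤ T
  pend_lt : ∀ c ∈ pend, c.atom.fst < c.atom.snd ∧ i ≤ c.atom.snd ∧ c.atom.snd < n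
  pend_good : ∀ c ∈ pend, c.GoodAt D 0
  pend_rest : ∀ c ∈ pend, c.rest c.cur ≤ T
  pend_pre : ∀ c ∈ pend, c.pre ≠ none
  slice_nodup : ∀ s ∈ slices, s.tuples.Nodup
  slice_lt : ∀ s ∈ slices, s.fst < s.snd ∧ s.snd < n
  cover : ∀ j < n, (∃ A ∈ atoms, i ≤ A.fst ∧ (A.fst = j ∨ A.snd = j)) ∨
    (∃ c ∈ pend, c.atom.fst = j ∨ c.atom.snd = j) ∨ ∃ s ∈ slices, s.fst = j ∨ s.snd = j
  count : pend.length + (atoms.filter fun A => decide (i ≤ A.fst)).length ≤ Y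

/-- The cursors of dimension `i`. -/
def boxCursors (atoms : List Atom) (i : ℕ) (pend : List Cursor) : List Cursor :=
  (atoms.filter fun A => decide (A.fst = i)).map Cursor.start
    ++ pend.filter fun c => decide (c.atom.snd = i)

section

variable {B D T n Y i mem memMax : ℕ} {atoms : List Atom} {pend : List Cursor}
  {slices : List Slice}

theorem BoxInv.loopInv (H : BoxInv D T n Y atoms i pend slices) :
    LoopInv D T i 0 ((boxCursors atoms i pend).map Cursor.atom) (boxCursors atoms i pend) := by
  refine ⟨rfl, ?_, ?_, ?_⟩ <;> intro c hc <;>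
    rcases List.mem_append.1 hc with hc | hc
  · obtain ⟨A, hA, rfl⟩ := List.mem_map.1 hc
    exact H.atom_good A (List.mem_filter.1 hA).1
  · exact H.pend_good c (List.mem_filter.1 hc).1
  · obtain ⟨A, hA, rfl⟩ := List.mem_map.1 hc
    have hi : A.fst = i := by simpa using (List.mem_filter.1 hA).2
    exact hi
  · obtain ⟨hc, hi⟩ := List.mem_filter.1 hc
    have := H.pend_pre c hc
    unfold Cursor.dim
    split
    · contradiction
    · simpa using hi
  · obtain ⟨A, hA, rfl⟩ := List.mem_map.1 hc
    exact H.atom_rest A (List.mem_filter.1 hA).1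
  · exact H.pend_rest c (List.mem_filter.1 hc).1

theorem length_filter_le_eq (atoms : List Atom) (i : ℕ) :
    (atoms.filter fun A => decide (A.fst = i)).length
      + (atoms.filter fun A => decide (i + 1 ≤ A.fst)).length
      = (atoms.filter fun A => decide (i ≤ A.fst)).length := by
  induction atoms with
  | nil => rfl
  | cons A atoms ih =>
    simp only [List.filter_cons, decide_eq_true_eq]
    split_ifs <;> (try simp only [List.length_cons]) <;> omega

theorem BoxInv.length_le (H : BoxInv D T n Y atoms i pend slices) :
    (boxCursors atoms i pend).length ≤ Y := by
  have h1 := H.count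
  have h2 := length_filter_le_eq atoms i
  have h3 := List.length_filter_le (fun c : Cursor => decide (c.atom.snd = i)) pend
  simp only [boxCursors, List.length_append, List.length_map]
  omega

theorem BoxInv.lt_of_mem (H : BoxInv D T n Y atoms i pend slices) {A : Atom}
    (hA : A ∈ (boxCursors atoms i pend).map Cursor.atom) : A.fst < A.snd ∧ A.snd < n := by
  obtain ⟨c, hc, rfl⟩ := List.mem_map.1 hA
  rcases List.mem_append.1 hc with hc | hc
  · obtain ⟨A, hA', rfl⟩ := List.mem_map.1 hc
    exact H.atom_lt A (List.mem_filter.1 hA').1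
  · have := H.pend_lt c (List.mem_filter.1 hc).1
    exact ⟨this.1, this.2.2⟩

theorem BoxInv.succ (H : BoxInv D T n Y atoms i pend slices) {S : List Slice} {u : ℕ}
    {sp : List Cursor}
    (F : RoundFacts D T i mem ((boxCursors atoms i pend).map Cursor.atom) S u sp) :
    BoxInv D T n Y atoms (i + 1) ((pend.filter fun c => !decide (c.atom.snd = i)) ++ sp)
      (slices ++ S) where
  atom_lt := H.atom_lt
  atom_good := H.atom_good
  atom_rest := H.atom_rest
  pend_lt c hc := by
    rcases List.mem_append.1 hc with hc | hc
    · obtain ⟨hc, hi⟩ := List.mem_filter.1 hc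
      have := H.pend_lt c hc
      have hi : c.atom.snd ≠ i := by simpa using hi
      omega
    · have h1 := F.spilled_atom c hc
      have h2 := H.lt_of_mem h1.1
      omega
  pend_good c hc := by
    rcases List.mem_append.1 hc with hc | hc
    · exact H.pend_good c (List.mem_filter.1 hc).1
    · exact F.good c hc
  pend_rest c hc := by
    rcases List.mem_append.1 hc with hc | hc
    · exact H.pend_rest c (List.mem_filter.1 hc).1
    · exact F.rest c hc
  pend_pre c hc := by
    rcases List.mem_append.1 hc with hc | hc
    · exact H.pend_pre c (List.mem_filter.1 hc).1
    · exact (F.spilled_atom c hc).2.2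
  slice_nodup s hs := (List.mem_append.1 hs).elim (H.slice_nodup s) (F.nodup s)
  slice_lt s hs := by
    rcases List.mem_append.1 hs with hs | hs
    · exact H.slice_lt s hs
    · obtain ⟨A, hA, h1, h2⟩ := F.slice_atom s hs
      rw [← h1, ← h2]
      exact H.lt_of_mem hA
  cover j hj := by
    have main : ∀ A ∈ (boxCursors atoms i pend).map Cursor.atom, (A.fst = j ∨ A.snd = j) →
        (∃ c ∈ (pend.filter fun c => !decide (c.atom.snd = i)) ++ sp,
          c.atom.fst = j ∨ c.atom.snd = j) ∨ ∃ s ∈ slices ++ S, s.fst = j ∨ s.snd = j := by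
      intro A hA hj
      rcases F.cover A hA with ⟨s, hs, h1, h2⟩ | ⟨c, hc, rfl⟩
      · exact Or.inr ⟨s, List.mem_append_right _ hs, by omega⟩
      · exact Or.inl ⟨c, List.mem_append_right _ hc, hj⟩
    rcases H.cover j hj with ⟨A, hA, hi, hj⟩ | ⟨c, hc, hj⟩ | ⟨s, hs, hj⟩
    · rcases hi.eq_or_lt with h | h
      · refine Or.inr (main A (List.mem_map.2 ⟨Cursor.start A, List.mem_append_left _
          (List.mem_map_of_mem (List.mem_filter.2 ⟨hA, by simp [h]⟩)), rfl⟩) hj)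
      · exact Or.inl ⟨A, hA, h, hj⟩
    · by_cases h : c.atom.snd = i
      · exact Or.inr (main c.atom (List.mem_map_of_mem (List.mem_append_right _
          (List.mem_filter.2 ⟨hc, by simp [h]⟩))) hj)
      · exact Or.inr (Or.inl ⟨c, List.mem_append_left _
          (List.mem_filter.2 ⟨hc, by simp [h]⟩), hj⟩)
    · exact Or.inr (Or.inr ⟨s, List.mem_append_left _ hs, hj⟩)
  -- An atom is either not yet reached or represented by at most one pending cursor; a cursor
  -- handled in this round yields at most one spilled cursor.
  count := by
    have h1 := H.count
    have h2 := length_filter_le_eq atoms i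
    have h3 := F.length
    have h4 := List.length_eq_length_filter_add (l := pend) fun c => decide (c.atom.snd = i)
    simp only [boxCursors, List.length_append, List.length_map] at h3 ⊢
    omega

theorem boxUp_succ (k leftover used : ℕ) (box : List (ℕ × WithTop ℕ)) :
    boxUp B D n memMax atoms (k + 1) i leftover pend slices used box =
      loop B (memMax / n + leftover)
        (fun l h S u sp => boxUp B D n memMax atoms k (i + 1) (memMax / n + leftover - u)
          ((pend.filter fun c => !decide (c.atom.snd = i)) ++ sp)
          (slices ++ S) (used + u) (box ++ [(l, h)]))
        (D + 1) 0 (boxCursors atoms i pend) := rfl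

/-- Each atom contributes its condition exactly through its current form: unvisited atom, pending
cursor or loaded slice. At the innermost level the first two kinds are gone, as `fst < snd < n`, and
the coverage invariant supplies what `mem_lftj` needs. -/
theorem boxUp_out (hB : 0 < B) (hY : Y ≤ memMax / n) (k leftover used : ℕ)
    (box : List (ℕ × WithTop ℕ)) (hk : i + k = n) (hbox : box.length = i)
    (H : BoxInv D T n Y atoms i pend slices) :
    (boxUp B D n memMax atoms k i leftover pend slices used box).out.Nodup ∧
    ∀ t, t ∈ (boxUp B D n memMax atoms k i leftover pend slices used box).out ↔
      t.length = n ∧ InBox box t ∧ (∀ s ∈ slices, s.Sat t) ∧ (∀ c ∈ pend, c.Sat t) ∧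
        ∀ A ∈ atoms, i ≤ A.fst → (Cursor.start A).Sat t := by
  induction k generalizing i leftover used box pend slices with
  | zero =>
    simp only [boxUp]
    refine ⟨lftj_nodup _ _ _ H.slice_nodup, fun t => ?_⟩
    have hp : ∀ c ∈ pend, False := fun c hc => by have := H.pend_lt c hc; omega
    have ha : ∀ A ∈ atoms, ¬ i ≤ A.fst := fun A hA => by have := H.atom_lt A hA; omega
    rw [mem_lftj]
    · simp only [List.nil_prefix, true_and, List.length_nil, Nat.zero_add, Nat.zero_le,
        forall_const]
      constructor
      · rintro ⟨h1, h2, h3⟩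
        exact ⟨by omega, h2, h3, fun c hc => (hp c hc).elim, fun A hA h => absurd h (ha A hA)⟩
      · rintro ⟨h1, h2, h3, -⟩
        exact ⟨by omega, h2, h3⟩
    · intro s hs
      have := H.slice_lt s hs
      simp only [List.length_nil]
      omega
    · intro j _ hj
      simp only [List.length_nil] at hj
      rcases H.cover j (by omega) with ⟨A, hA, hi, -⟩ | ⟨c, hc, -⟩ | h
      · exact absurd hi (ha A hA)
      · exact (hp c hc).elim
      · exact h
  | succ k ih =>
    rw [boxUp_succ]
    have hlen : ((boxCursors atoms i pend).map Cursor.atom).length ≤ memMax / n + leftover := by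
      rw [List.length_map]
      have := H.length_le
      omega
    obtain ⟨r1, r2⟩ := loop_out (L := (boxCursors atoms i pend).map Cursor.atom)
      (Q := fun t => t.length = n ∧ InBox box t ∧ (∀ s ∈ slices, s.Sat t) ∧
        (∀ c ∈ pend.filter fun c => !decide (c.atom.snd = i), c.Sat t) ∧
          ∀ A ∈ atoms, i + 1 ≤ A.fst → (Cursor.start A).Sat t) hB hlen
      (body := fun l h S u sp => boxUp B D n memMax atoms k (i + 1) (memMax / n + leftover - u)
          ((pend.filter fun c => !decide (c.atom.snd = i)) ++ sp)
          (slices ++ S) (used + u) (box ++ [(l, h)]))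
      (fun l h S u sp F => by
        obtain ⟨a1, a2⟩ := ih (i := i + 1) (memMax / n + leftover - u) (used + u)
          (box ++ [(l, h)]) (by omega) (by simp [hbox]) (H.succ F)
        refine ⟨a1, fun t => ?_⟩
        rw [a2, inBox_concat, hbox, List.forall_mem_append, List.forall_mem_append]
        tauto)
      (D + 1) H.loopInv (by omega) (by omega)
    refine ⟨r1, fun t => ?_⟩
    rw [r2]
    simp only [boxCursors, List.forall_mem_append, List.forall_mem_map, List.mem_filter,
      decide_eq_true_eq, Bool.not_eq_eq_eq_not, Bool.not_true, decide_eq_false_iff_not, and_imp]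
    constructor
    · rintro ⟨⟨h1, h2, h3, h4, h5⟩, -, h6, h7⟩
      refine ⟨h1, h2, h3, fun c hc => ?_, fun A hA hi => ?_⟩
      · by_cases h : c.atom.snd = i
        · exact h7 c hc h
        · exact h4 c hc h
      · rcases hi.eq_or_lt with h | h
        · exact h6 A hA h.symm
        · exact h5 A hA h
    · rintro ⟨h1, h2, h3, h4, h5⟩
      exact ⟨⟨h1, h2, h3, fun c hc _ => h4 c hc, fun A hA h => h5 A hA (by omega)⟩,
        Nat.zero_le _, fun A hA h => h5 A hA h.ge, fun c hc _ => h4 c hc⟩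

/-- What a round uses is subtracted from the leftover handed on, so `used + leftover` grows by at
most one share per dimension; the 3 counts the buffers. -/
theorem boxUp_peak (hB : 0 < B) (hY : Y ≤ memMax / n) (k leftover used : ℕ)
    (box : List (ℕ × WithTop ℕ)) (H : BoxInv D T n Y atoms i pend slices) :
    (boxUp B D n memMax atoms k i leftover pend slices used box).peak ≤
      used + leftover + k * (memMax / n) + 3 := by
  induction k generalizing i leftover used box pend slices with
  | zero =>
    simp only [boxUp]
    omega
  | succ k ih =>
    rw [boxUp_succ]
    have hlen : ((boxCursors atoms i pend).map Cursor.atom).length ≤ memMax / n + leftover := by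
      rw [List.length_map]
      have := H.length_le
      omega
    refine loop_peak hB hlen (fun l h S u sp F => ?_) (D + 1) H.loopInv
    refine (ih _ _ _ (H.succ F)).trans ?_
    have := F.used
    rw [Nat.add_mul]
    omega

/-- Bound for the reads of `k` nested dimensions with at most `ρ` rounds each, where a round costs
`κ`. -/
def readBound (ρ κ : ℝ) : ℕ → ℝ
  | 0 => 0
  | k + 1 => ρ * (κ + readBound ρ κ k)

theorem readBound_nonneg {ρ κ : ℝ} (hρ : 0 ≤ ρ) (hκ : 0 ≤ κ) (k : ℕ) : 0 ≤ readBound ρ κ k := by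
  induction k with
  | zero => exact le_rfl
  | succ k ih => exact mul_nonneg hρ (add_nonneg hκ ih)

/-- The actual share depends on the number of cursors, which is at most `Y`; replacing it by the
smaller uniform `s` gives one round count for all dimensions. -/
theorem BoxInv.loop_reads_le (H : BoxInv D T n Y atoms i pend slices) (hB : 0 < B)
    {s : ℕ} (hs : 3 ≤ s) (hsY : s * Y ≤ mem) {κ X : ℝ} (hX : 0 ≤ X) (hκ : 12 * (mem : ℝ) ≤ κ)
    {body : ℕ → WithTop ℕ → List Slice → ℕ → List Cursor → Result} {Z : Prop}
    (hbody : ∀ l h S u sp,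
      RoundFacts D T i mem ((boxCursors atoms i pend).map Cursor.atom) S u sp →
      (Z → sp = [] ∧ (body l h S u sp).spills = 0) → ((body l h S u sp).reads : ℝ) ≤ X)
    (hZ : Z → (loop B mem body (D + 1) 0 (boxCursors atoms i pend)).spills = 0) :
    ((loop B mem body (D + 1) 0 (boxCursors atoms i pend)).reads : ℝ) ≤
      (2 * Y * T / (s * B) + 1) * (κ + X) := by
  have hsB : (0 : ℝ) < s * B := by
    have : (0 : ℝ) < s := by exact_mod_cast (by omega : 0 < s)
    have : (0 : ℝ) < B := by exact_mod_cast hB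
    positivity
  have hκ0 : 0 ≤ κ := le_trans (by positivity) hκ
  by_cases hL : boxCursors atoms i pend = []
  · rw [hL, loop_nil] at hZ ⊢
    rw [hL] at hbody
    have := hbody 0 ⊤ [] 0 [] RoundFacts.nil fun z => ⟨rfl, by simpa [Result.seq] using hZ z⟩
    simp only [Result.seq, Nat.zero_add]
    refine this.trans ?_
    have h1 : (0 : ℝ) ≤ 2 * Y * T / (s * B) := by positivity
    nlinarith [mul_nonneg h1 (add_nonneg hκ0 hX)]
  · set cs := boxCursors atoms i pend with hcs
    have hpos : 0 < cs.length := List.length_pos_iff.2 hL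
    have hle : s ≤ mem / cs.length := by
      rw [Nat.le_div_iff_mul_le hpos]
      exact (Nat.mul_le_mul_left _ H.length_le).trans hsY
    have hLen : (cs.map Cursor.atom).length = cs.length := List.length_map _
    have main := loop_reads (Z := Z) (s := mem / cs.length) hX hB (by rw [hLen])
      (hs.trans hle) hbody (D + 1) H.loopInv hZ
    have hpot : (cs.map (Cursor.potential 0)).sum ≤ Y * (2 * T) :=
      H.loopInv.potential_le.trans (Nat.mul_le_mul_right _ H.length_le)
    rw [← hcs] at main
    set w := mem / cs.length * B
    have hw : s * B ≤ w := Nat.mul_le_mul_right _ hle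
    have hw' : (s * B : ℝ) ≤ w := by exact_mod_cast hw
    have hw0 : (0 : ℝ) < w := hsB.trans_le hw'
    rw [mul_comm, ← le_div_iff₀ hw0] at main
    refine main.trans ?_
    rw [mul_div_right_comm]
    refine mul_le_mul ?_ (by linarith) (by positivity) (by positivity)
    rw [Nat.cast_add, add_div, div_self hw0.ne']
    refine add_le_add ?_ le_rfl
    refine div_le_div₀ (by positivity) ?_ hsB hw'
    calc ((cs.map (Cursor.potential 0)).sum : ℝ) ≤ ((Y * (2 * T) : ℕ) : ℝ) := by exact_mod_cast hpot
      _ = 2 * Y * T := by push_cast; ring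

theorem boxUp_reads (hB : 0 < B) {s : ℕ} (hs : 3 ≤ s) (hsY : s * Y ≤ memMax / n)
    (k leftover used : ℕ) (box : List (ℕ × WithTop ℕ)) (hk : i + k = n)
    (hleft : leftover ≤ i * (memMax / n)) (H : BoxInv D T n Y atoms i pend slices) :
    ((boxUp B D n memMax atoms k i leftover pend slices used box).reads : ℝ) ≤
      readBound (2 * Y * T / (s * B) + 1) (12 * memMax) k := by
  induction k generalizing i leftover used box pend slices with
  | zero => simp [boxUp, readBound]
  | succ k ih =>
    rw [boxUp_succ]
    have hm : memMax / n + leftover ≤ (i + 1) * (memMax / n) := by rw [Nat.add_mul]; omega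
    have hm' : memMax / n + leftover ≤ memMax :=
      hm.trans ((Nat.mul_le_mul_right _ (by omega : i + 1 ≤ n)).trans (Nat.mul_div_le _ _))
    refine H.loop_reads_le (Z := False) hB hs (by omega)
      (readBound_nonneg (by positivity) (by positivity) k) (by exact_mod_cast (by omega))
      (fun l h S u sp F _ => ?_) False.elim
    exact ih _ _ _ (by omega) (by omega) (H.succ F)

/-- Without spills no cursor is ever pending, so dimension `n - 1` is empty: it could only be the
first variable of an atom, which `fst < snd < n` forbids. Its one round is free, hence one factor
fewer than in `boxUp_reads`. -/
theorem boxUp_reads_of_spills (hB : 0 < B) {s : ℕ} (hs : 3 ≤ s) (hsY : s * Y ≤ memMax / n)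
    (k leftover used : ℕ) (box : List (ℕ × WithTop ℕ)) (hk : i + (k + 1) = n)
    (hleft : leftover ≤ i * (memMax / n)) (H : BoxInv D T n Y atoms i [] slices)
    (hspills : (boxUp B D n memMax atoms (k + 1) i leftover [] slices used box).spills = 0) :
    ((boxUp B D n memMax atoms (k + 1) i leftover [] slices used box).reads : ℝ) ≤
      readBound (2 * Y * T / (s * B) + 1) (12 * memMax) k := by
  induction k generalizing i leftover used box slices with
  | zero =>
    have hcs : boxCursors atoms i [] = [] := by
      simp only [boxCursors, List.filter_nil, List.append_nil, List.map_eq_nil_iff,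
        List.filter_eq_nil_iff, decide_eq_true_eq]
      intro A hA
      have := H.atom_lt A hA
      omega
    rw [boxUp_succ, hcs, loop_nil]
    simp [Result.seq, boxUp, readBound]
  | succ k ih =>
    rw [boxUp_succ] at hspills ⊢
    have hm : memMax / n + leftover ≤ (i + 1) * (memMax / n) := by rw [Nat.add_mul]; omega
    have hm' : memMax / n + leftover ≤ memMax :=
      hm.trans ((Nat.mul_le_mul_right _ (by omega : i + 1 ≤ n)).trans (Nat.mul_div_le _ _))
    refine H.loop_reads_le (Z := True) hB hs (by omega)
      (readBound_nonneg (by positivity) (by positivity) k) (by exact_mod_cast (by omega))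
      (fun l h S u sp F hz => ?_) fun _ => hspills
    obtain ⟨rfl, hz⟩ := hz trivial
    exact ih _ _ _ (by omega) (by omega) (H.succ F) hz

end

/-! ### TrieArrays of relations -/

theorem length_keys (R : Finset (ℕ × ℕ)) : (keys R).length ≤ R.card := by
  unfold keys
  rw [Finset.length_sort]
  exact Finset.card_image_le

theorem sortedLT_keys (R : Finset (ℕ × ℕ)) : (keys R).Pairwise (· < ·) :=
  (Finset.sortedLT_sort _).pairwise

theorem sortedLT_children (R : Finset (ℕ × ℕ)) (a : ℕ) : (children R a).Pairwise (· < ·) :=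
  (Finset.sortedLT_sort _).pairwise

theorem mem_keys {R : Finset (ℕ × ℕ)} {a : ℕ} : a ∈ keys R ↔ ∃ b, (a, b) ∈ R := by
  simp [keys]

theorem mem_children {R : Finset (ℕ × ℕ)} {a b : ℕ} : b ∈ children R a ↔ (a, b) ∈ R := by
  simp [children]

/-- This justifies the offsets of a TrieArray: the lengths of the first `j` lists add up to the
place where list `j` begins. -/
theorem flatMap_getElem? {α : Type*} (L : List α) (f : α → List ℕ) (j r : ℕ) (hj : j < L.length)
    (hr : r < (f L[j]).length) :
    (L.flatMap f)[((L.take j).map fun a => (f a).length).sum + r]? = (f L[j])[r]? := by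
  induction L generalizing j with
  | nil => simp at hj
  | cons a L ih =>
    cases j with
    | zero =>
      simp only [List.take_zero, List.map_nil, List.sum_nil, Nat.zero_add, List.flatMap_cons,
        List.getElem_cons_zero] at hr ⊢
      rw [List.getElem?_append_left hr]
    | succ j =>
      simp only [List.take_succ_cons, List.map_cons, List.sum_cons, List.flatMap_cons,
        List.getElem_cons_succ] at hr ⊢
      rw [List.getElem?_append_right (by omega), ← ih j (by simpa using hj) hr]
      congr 1
      omega

theorem sum_length_take_succ {α : Type*} (L : List α) (f : α → List ℕ) (j : ℕ)
    (hj : j < L.length) :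
    ((L.take (j + 1)).map fun a => (f a).length).sum =
      ((L.take j).map fun a => (f a).length).sum + (f L[j]).length := by
  rw [List.take_succ_eq_append_getElem hj, List.map_append, List.sum_append]
  simp

section

variable (R : Finset (ℕ × ℕ)) (u v : ℕ)

theorem start_idx {j : ℕ} (hj : j ≤ (keys R).length) :
    (Cursor.start ⟨u, v, TrieArray.ofRel R⟩).idx j
      = (((keys R).take j).map fun a => (children R a).length).sum := by
  simp only [Cursor.idx, Cursor.start, TrieArray.ofRel]
  rw [List.getD_eq_getElem _ _ (by simp; omega)]
  simp

theorem start_key {j : ℕ} (hj : j < (keys R).length) :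
    (Cursor.start ⟨u, v, TrieArray.ofRel R⟩).key j = (keys R)[j] := by
  simp only [Cursor.key, Cursor.start, TrieArray.ofRel]
  rw [List.getD_eq_getElem _ _ hj]

theorem start_idx_succ {j : ℕ} (hj : j < (keys R).length) :
    (Cursor.start ⟨u, v, TrieArray.ofRel R⟩).idx (j + 1)
      = (Cursor.start ⟨u, v, TrieArray.ofRel R⟩).idx j + (children R (keys R)[j]).length := by
  rw [start_idx R u v hj, start_idx R u v hj.le, sum_length_take_succ _ _ _ hj]

theorem start_child {j k : ℕ} (hj : j < (keys R).length)
    (h1 : (Cursor.start ⟨u, v, TrieArray.ofRel R⟩).idx j ≤ k)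
    (h2 : k < (Cursor.start ⟨u, v, TrieArray.ofRel R⟩).idx (j + 1)) :
    ∃ h : k - (Cursor.start ⟨u, v, TrieArray.ofRel R⟩).idx j < (children R (keys R)[j]).length,
      (TrieArray.ofRel R).val1.getD k 0 = (children R (keys R)[j])[
        k - (Cursor.start ⟨u, v, TrieArray.ofRel R⟩).idx j] := by
  rw [start_idx_succ R u v hj] at h2
  refine ⟨by omega, ?_⟩
  obtain ⟨r, rfl⟩ := Nat.exists_eq_add_of_le h1
  have hr : r < (children R (keys R)[j]).length := by omega
  have := flatMap_getElem? (keys R) (children R) j r hj hr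
  rw [← start_idx R u v hj.le] at this
  have hv : (TrieArray.ofRel R).val1 = (keys R).flatMap (children R) := rfl
  rw [List.getD_eq_getElem?_getD, hv, this, List.getElem?_eq_getElem hr, Option.getD_some]
  simp

theorem start_good {D : ℕ} (hR : ∀ p ∈ R, p.1 < D ∧ p.2 < D) :
    (Cursor.start ⟨u, v, TrieArray.ofRel R⟩).GoodAt D 0 where
  le := Nat.zero_le _
  mono i j _ hij hj := by
    have hj : j < (keys R).length := hj
    rw [start_key R u v (hij.trans hj), start_key R u v hj]
    exact List.pairwise_iff_getElem.1 (sortedLT_keys R) i j _ _ hij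
  low _ _ _ := Nat.zero_le _
  top j _ hj := by
    have hj : j < (keys R).length := hj
    rw [start_key R u v hj]
    obtain ⟨b, hb⟩ := mem_keys.1 (List.getElem_mem hj)
    exact (hR _ hb).1
  idx_le _ j _ hj := by
    rw [start_idx_succ R u v hj]
    exact Nat.le_add_right _ _
  child_mono _ j _ hj i k hi hik hk := by
    obtain ⟨a1, a2⟩ := start_child R u v hj hi (hik.trans hk)
    obtain ⟨b1, b2⟩ := start_child R u v hj (hi.trans hik.le) hk
    change (TrieArray.ofRel R).val1.getD i 0 < (TrieArray.ofRel R).val1.getD k 0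
    rw [a2, b2]
    exact List.pairwise_iff_getElem.1 (sortedLT_children R _) _ _ _ _ (by omega)
  child_top _ j _ hj k hk hk' := by
    obtain ⟨a1, a2⟩ := start_child R u v hj hk hk'
    change (TrieArray.ofRel R).val1.getD k 0 < D
    rw [a2]
    exact (hR _ (mem_children.1 (List.getElem_mem a1))).2

theorem start_sat (t : List ℕ) :
    (Cursor.start ⟨u, v, TrieArray.ofRel R⟩).Sat t ↔ (t.getD u 0, t.getD v 0) ∈ R := by
  unfold Cursor.Sat
  rw [Cursor.mem_slice]
  change (∃ j, 0 ≤ j ∧ j < (keys R).length ∧ (t.getD u 0 = Cursor.key _ j ∧ ∃ k, _ ∧ _ ∧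
    t.getD v 0 = (TrieArray.ofRel R).val1.getD k 0)) ↔ _
  generalize t.getD u 0 = a
  generalize t.getD v 0 = b
  constructor
  · rintro ⟨j, -, hj, h1, k, h2, h3, h4⟩
    obtain ⟨a1, a2⟩ := start_child R u v hj h2 h3
    rw [start_key R u v hj] at h1
    rw [a2] at h4
    rw [h1, h4]
    exact mem_children.1 (List.getElem_mem a1)
  · intro h
    obtain ⟨j, hj, rfl⟩ := List.getElem_of_mem (mem_keys.2 ⟨b, h⟩)
    obtain ⟨r, hr, rfl⟩ := List.getElem_of_mem (mem_children.2 h)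
    have h2 := start_idx_succ R u v hj
    refine ⟨j, Nat.zero_le _, hj, (start_key R u v hj).symm,
      (Cursor.start ⟨u, v, TrieArray.ofRel R⟩).idx j + r, by omega, by omega, ?_⟩
    obtain ⟨a1, a2⟩ := start_child R u v hj (k := (Cursor.start ⟨u, v,
      TrieArray.ofRel R⟩).idx j + r) (by omega) (by omega)
    rw [a2]
    simp

theorem sum_children : ((keys R).map fun a => (children R a).length).sum = R.card := by
  have h1 : R.card = ∑ a ∈ R.image Prod.fst, (R.filter fun p => p.1 = a).card :=
    Finset.card_eq_sum_card_image Prod.fst R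
  have h2 : ∀ a, (children R a).length = (R.filter fun p => p.1 = a).card := by
    intro a
    unfold children
    rw [Finset.length_sort, Finset.card_image_of_injOn]
    rintro ⟨x, y⟩ hx ⟨x', y'⟩ hy h
    simp only [Finset.coe_filter, Set.mem_ofPred_eq] at hx hy
    exact Prod.ext (hx.2.trans hy.2.symm) h
  simp only [h2, h1]
  unfold keys
  rw [← List.sum_toFinset _ (Finset.sort_nodup _ _), Finset.sort_toFinset]

/-- Two words per key and one per child; there are at most `R.card` keys and exactly `R.card`
children in total. -/
theorem start_rest_le :
    (Cursor.start ⟨u, v, TrieArray.ofRel R⟩).rest (Cursor.start ⟨u, v, TrieArray.ofRel R⟩).cur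
      ≤ 3 * R.card := by
  have h1 := length_keys R
  have h2 : (Cursor.start ⟨u, v, TrieArray.ofRel R⟩).idx (keys R).length = R.card := by
    rw [start_idx R u v le_rfl, List.take_length, sum_children]
  change 2 * ((keys R).length - 0) + ((Cursor.start ⟨u, v, TrieArray.ofRel R⟩).idx
    (keys R).length - _) ≤ _
  omega

end

/-! ### The triangle query -/

section

variable {N : ℕ} (G : SimpleGraph (Fin N)) [DecidableRel G.Adj]

theorem mem_directedEdges {a b : ℕ} : (a, b) ∈ directedEdges G ↔
    ∃ x y : Fin N, x < y ∧ G.Adj x y ∧ (x : ℕ) = a ∧ (y : ℕ) = b := by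
  simp [directedEdges, and_assoc]

theorem card_directedEdges : (directedEdges G).card = G.edgeFinset.card := by
  unfold directedEdges
  rw [Finset.card_image_of_injective]
  · refine Finset.card_nbij (fun p => s(p.1, p.2)) ?_ ?_ ?_
    · rintro ⟨x, y⟩ h
      simpa using (Finset.mem_filter.1 h).2.2
    · rintro ⟨x, y⟩ h ⟨x', y'⟩ h' heq
      have h := (Finset.mem_filter.1 (Finset.mem_coe.1 h)).2.1
      have h' := (Finset.mem_filter.1 (Finset.mem_coe.1 h')).2.1
      simp only [Sym2.eq_iff] at heq
      rcases heq with ⟨rfl, rfl⟩ | ⟨rfl, rfl⟩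
      · rfl
      · exact absurd (lt_trans h h') (lt_irrefl _)
    · intro e he
      induction e with
      | _ x y =>
        have hxy : G.Adj x y := by simpa using he
        rcases lt_trichotomy x y with h | rfl | h
        · exact ⟨(x, y), by simp [h, hxy], rfl⟩
        · exact absurd hxy (G.irrefl)
        · exact ⟨(y, x), by simp [h, hxy.symm], Sym2.eq_swap⟩
  · rintro ⟨x, y⟩ ⟨x', y'⟩ h
    simp only [Prod.mk.injEq] at h
    exact Prod.ext (Fin.ext h.1) (Fin.ext h.2)

/-- The triangles of `G`, as increasing triples. -/
def triangles : Finset (Fin N × Fin N × Fin N) :=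
  Finset.univ.filter fun p => p.1 < p.2.1 ∧ p.2.1 < p.2.2 ∧ G.Adj p.1 p.2.1 ∧ G.Adj p.1 p.2.2 ∧
    G.Adj p.2.1 p.2.2

/-- An increasing triple is determined by its underlying set. Only this inequality is needed, as the
count enters an upper bound. -/
theorem card_triangles_le : (triangles G).card ≤ (G.cliqueFinset 3).card := by
  refine Finset.card_le_card_of_injOn (fun p => {p.1, p.2.1, p.2.2}) ?_ ?_
  · rintro ⟨x, y, z⟩ h
    obtain ⟨-, -, h1, h2, h3⟩ := (Finset.mem_filter.1 (Finset.mem_coe.1 h)).2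
    exact Finset.mem_coe.2 ((SimpleGraph.mem_cliqueFinset_iff).2
      (SimpleGraph.is3Clique_triple_iff.2 ⟨h1, h2, h3⟩))
  · rintro ⟨x, y, z⟩ h ⟨x', y', z'⟩ h' heq
    obtain ⟨a1, a2, -⟩ := (Finset.mem_filter.1 (Finset.mem_coe.1 h)).2
    obtain ⟨b1, b2, -⟩ := (Finset.mem_filter.1 (Finset.mem_coe.1 h')).2
    have heq : ({x, y, z} : Finset (Fin N)) = {x', y', z'} := heq
    have hx : x ∈ ({x', y', z'} : Finset (Fin N)) := heq ▸ by simp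
    have hy : y ∈ ({x', y', z'} : Finset (Fin N)) := heq ▸ by simp
    have hz : z ∈ ({x', y', z'} : Finset (Fin N)) := heq ▸ by simp
    simp only [Finset.mem_insert, Finset.mem_singleton, Fin.ext_iff] at hx hy hz
    simp only [Fin.lt_def] at a1 a2 b1 b2
    simp only [Prod.mk.injEq, Fin.ext_iff]
    omega

theorem length_le_of_mem {L : List (List ℕ)} (hL : L.Nodup)
    (h : ∀ t ∈ L, ∃ x y z : Fin N, x < y ∧ y < z ∧ G.Adj x y ∧ G.Adj x z ∧ G.Adj y z ∧
      t = [(x : ℕ), (y : ℕ), (z : ℕ)]) : L.length ≤ (G.cliqueFinset 3).card := by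
  rw [← List.toFinset_card_of_nodup hL]
  refine le_trans ?_ (card_triangles_le G)
  refine le_trans (Finset.card_le_card ?_) (Finset.card_image_le
    (s := triangles G) (f := fun p => [(p.1 : ℕ), (p.2.1 : ℕ), (p.2.2 : ℕ)]))
  intro t ht
  obtain ⟨x, y, z, h1, h2, h3, h4, h5, rfl⟩ := h t (List.mem_toFinset.1 ht)
  exact Finset.mem_image.2 ⟨(x, y, z), by simp [triangles, *], rfl⟩

theorem triangle_boxInv : BoxInv N (3 * G.edgeFinset.card) 3 3 (triangleQuery (directedEdges G)) 0
    [] [] := by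
  have hE : ∀ p ∈ directedEdges G, p.1 < N ∧ p.2 < N := by
    rintro ⟨a, b⟩ h
    obtain ⟨x, y, -, -, rfl, rfl⟩ := (mem_directedEdges G).1 h
    exact ⟨x.2, y.2⟩
  have hgood := fun u v => start_good (directedEdges G) u v hE
  have hrest := fun u v => start_rest_le (directedEdges G) u v
  rw [card_directedEdges] at hrest
  constructor
  case cover =>
    intro j hj
    refine Or.inl ?_
    interval_cases j <;> simp [triangleQuery]
  all_goals simp [triangleQuery, hgood, hrest]

theorem triangleRun_out {M B : ℕ} (hB : 0 < B) (hM : 60 * B ≤ M) :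
    (triangleRun G M B).out.Nodup ∧ ∀ t : List ℕ, t ∈ (triangleRun G M B).out ↔
      ∃ x y z : Fin N, x < y ∧ y < z ∧ G.Adj x y ∧ G.Adj x z ∧ G.Adj y z ∧
        t = [(x : ℕ), (y : ℕ), (z : ℕ)] := by
  have hm : 60 ≤ M / B := (Nat.le_div_iff_mul_le hB).2 hM
  obtain ⟨h1, h2⟩ := boxUp_out (i := 0) (n := 3) hB (memMax := M / B - 3) (by omega) 3 0 0 [] rfl rfl
    (triangle_boxInv G)
  refine ⟨h1, fun t => (h2 t).trans ?_⟩
  simp only [triangleQuery, List.forall_mem_cons, start_sat, Nat.zero_le, forall_const,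
    mem_directedEdges]
  constructor
  · rintro ⟨hl, -, -, -, ⟨x, y, hxy, h1, h2, h3⟩, ⟨x', z, -, h4, h5, h6⟩,
      ⟨y', z', hyz, h7, h8, h9⟩, -⟩
    -- The three edges come with separate witnesses in `Fin N`; they agree because they have the
    -- same coordinates of `t` as values.
    obtain rfl : x' = x := Fin.ext (h5.trans h2.symm)
    obtain rfl : y' = y := Fin.ext (h8.trans h3.symm)
    obtain rfl : z' = z := Fin.ext (h9.trans h6.symm)
    refine ⟨x', y', z', hxy, hyz, h1, h4, h7, ?_⟩
    obtain ⟨a, b, c, rfl⟩ := List.length_eq_three.1 hl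
    simp at h2 h3 h6
    rw [h2, h3, h6]
  · rintro ⟨x, y, z, hxy, hyz, h1, h2, h3, rfl⟩
    refine ⟨rfl, by simp [InBox], by simp, by simp, ⟨x, y, hxy, h1, rfl, rfl⟩,
      ⟨x, z, hxy.trans hyz, h2, rfl, rfl⟩, ⟨y, z, hyz, h3, rfl, rfl⟩, by simp⟩

theorem triangleRun_peak {M B : ℕ} (hB : 0 < B) (hM : 60 * B ≤ M) :
    (triangleRun G M B).peak * B ≤ M := by
  have hm : 60 ≤ M / B := (Nat.le_div_iff_mul_le hB).2 hM
  have h := boxUp_peak hB (memMax := M / B - 3) (by omega) 3 0 0 [] (triangle_boxInv G)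
  have h' : (triangleRun G M B).peak ≤ M / B := h.trans (by omega)
  exact (Nat.mul_le_mul_right _ h').trans (Nat.div_mul_le_self _ _)

/-- With three cursors of `3e` words, twice the total is `18e`; dividing by `s * B ≥ M / 11` gives
`198 = 18 * 11`. The final round is absorbed by `1 ≤ (1 / δ) * (e / M)`, the place where the graph
must be large. -/
theorem rounds_le {δ : ℝ} (hδ : 0 < δ) {e M B : ℕ} (hB : 0 < B) (hM : 60 * B ≤ M)
    (he : δ * M ≤ e) :
    2 * ((3 : ℕ) : ℝ) * ((3 * e : ℕ) : ℝ) / (((M / B - 3) / 9 : ℕ) * B) + 1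
      ≤ (198 + 1 / δ) * (e / M) := by
  have hm : 60 ≤ M / B := (Nat.le_div_iff_mul_le hB).2 hM
  have hM0 : (0 : ℝ) < M := by exact_mod_cast (by omega : 0 < M)
  set s := (M / B - 3) / 9 with hs
  have hs6 : 6 ≤ s := by omega
  -- `s` is a ninth of the available blocks, three dimensions times three cursors, rounded down. The
  -- loss from the buffers and the rounding is covered by 11 in place of 9 because `M / B ≥ 60`.
  have hMs : M ≤ 11 * (s * B) := by
    have h1 := Nat.lt_div_mul_add (a := M) hB
    have h2 : M / B + 1 ≤ 11 * s := by omega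
    have h3 := Nat.mul_le_mul_right B h2
    rw [Nat.add_mul] at h3
    rw [← mul_assoc]
    omega
  have hMs' : (M : ℝ) ≤ 11 * (s * B) := by exact_mod_cast hMs
  have hsB : (0 : ℝ) < s * B := by linarith
  have h1 : 2 * ((3 : ℕ) : ℝ) * ((3 * e : ℕ) : ℝ) / (s * B) ≤ 198 * (e / M) := by
    rw [← mul_div_assoc, div_le_div_iff₀ hsB hM0]
    push_cast
    have := mul_le_mul_of_nonneg_left hMs' (Nat.cast_nonneg (α := ℝ) e)
    linarith
  have h2 : 1 ≤ 1 / δ * (e / M : ℝ) := by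
    rw [div_mul_div_comm, one_mul, le_div_iff₀ (by positivity), one_mul]
    exact he
  linarith

theorem ios_le {r : Result} {B : ℕ} (hB : 0 < B) {K : ℕ} (hK : r.out.length ≤ K) :
    ((r.ios B 3 : ℕ) : ℝ) ≤ r.reads + 3 * (K / B) + 1 := by
  have hB0 : (0 : ℝ) < B := by exact_mod_cast hB
  have h1 : (3 * r.out.length) ⌈/⌉ B ≤ 3 * K / B + 1 := by
    rw [ceilDiv_le_iff_le_mul hB]
    have := Nat.lt_mul_div_succ (3 * K) hB
    nlinarith
  have h2 : (((3 * r.out.length) ⌈/⌉ B : ℕ) : ℝ) ≤ ((3 * K / B : ℕ) : ℝ) + 1 := by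
    exact_mod_cast h1
  have h3 : ((3 * K / B : ℕ) : ℝ) ≤ 3 * (K / B) := by
    have := Nat.cast_div_le (α := ℝ) (m := 3 * K) (n := B)
    push_cast at this
    rwa [mul_div_assoc] at this
  unfold Result.ios
  push_cast
  linarith

end

end BoxedLFTJ

/-! ### The two I/O bounds for the triangle query -/

theorem mainTheorem6 (δ : ℝ) (hδ : 0 < δ) :
    ∃ C : ℝ, 0 < C ∧
      ∀ (N : ℕ) (G : SimpleGraph (Fin N)) [DecidableRel G.Adj] (M B : ℕ),
        0 < B → 60 * B ≤ M → δ * (M : ℝ) ≤ (G.edgeFinset.card : ℝ) →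
        (BoxedLFTJ.triangleRun G M B).out.Nodup ∧
        (∀ t : List ℕ, t ∈ (BoxedLFTJ.triangleRun G M B).out ↔
          ∃ x y z : Fin N, x < y ∧ y < z ∧ G.Adj x y ∧ G.Adj x z ∧ G.Adj y z ∧
            t = [(x : ℕ), (y : ℕ), (z : ℕ)]) ∧
        (BoxedLFTJ.triangleRun G M B).peak * B ≤ M ∧
        (((BoxedLFTJ.triangleRun G M B).ios B 3 : ℕ) : ℝ) ≤
          C * ((G.edgeFinset.card : ℝ) ^ 3 / ((M : ℝ) ^ 2 * (B : ℝ))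
            + ((G.cliqueFinset 3).card : ℝ) / (B : ℝ)) ∧
        ((BoxedLFTJ.triangleRun G M B).spills = 0 →
          (((BoxedLFTJ.triangleRun G M B).ios B 3 : ℕ) : ℝ) ≤
            C * ((G.edgeFinset.card : ℝ) ^ 2 / ((M : ℝ) * (B : ℝ))
              + ((G.cliqueFinset 3).card : ℝ) / (B : ℝ))) := by
  have hA : (198 : ℝ) ≤ 198 + 1 / δ := by
    have : (0 : ℝ) < 1 / δ := by positivity
    linarith
  set A : ℝ := 198 + 1 / δ with hAdef
  -- With `x = A * (e / M) ≥ 1`, three dimensions cost `12μ(x + x² + x³) ≤ 36x³μ` where `μ = M / B`.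
  -- One more `x³μ` pays for the partial output block, giving 37. The same constant covers the 25
  -- `A²` of the case without spills, as `A ≥ 1`.
  refine ⟨37 * A ^ 3, by positivity, fun N G _ M B hB hM he => ?_⟩
  obtain ⟨h1, h2⟩ := BoxedLFTJ.triangleRun_out G hB hM
  have hlen := BoxedLFTJ.length_le_of_mem G h1 fun t ht => (h2 t).1 ht
  have hios := BoxedLFTJ.ios_le hB hlen
  have hm : 60 ≤ M / B := (Nat.le_div_iff_mul_le hB).2 hM
  have hB0 : (0 : ℝ) < B := by exact_mod_cast hB
  have hM0 : (0 : ℝ) < M := by exact_mod_cast (by omega : 0 < M)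
  have hρ := BoxedLFTJ.rounds_le hδ hB hM he
  have hρ1 : 1 ≤ 2 * ((3 : ℕ) : ℝ) * ((3 * G.edgeFinset.card : ℕ) : ℝ)
      / (((M / B - 3) / 9 : ℕ) * B) + 1 := le_add_of_nonneg_left (by positivity)
  have hall := BoxedLFTJ.boxUp_reads (memMax := M / B - 3) (s := (M / B - 3) / 9) hB (by omega)
    (by omega) 3 0 0 [] rfl (Nat.zero_le _) (BoxedLFTJ.triangle_boxInv G)
  have hnone := BoxedLFTJ.boxUp_reads_of_spills (memMax := M / B - 3) (s := (M / B - 3) / 9) hB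
    (by omega) (by omega) 2 0 0 [] rfl (Nat.zero_le _) (BoxedLFTJ.triangle_boxInv G)
  have hκ : 12 * ((M / B - 3 : ℕ) : ℝ) ≤ 12 * (M / B) := by
    have a1 : ((M / B - 3 : ℕ) : ℝ) ≤ ((M / B : ℕ) : ℝ) := by
      exact_mod_cast Nat.sub_le _ _
    have a2 : ((M / B : ℕ) : ℝ) ≤ M / B := Nat.cast_div_le
    linarith
  have hμ : (1 : ℝ) ≤ M / B := by
    rw [le_div_iff₀ hB0, one_mul]
    exact_mod_cast (by omega : B ≤ M)
  have hκ0 : (0 : ℝ) ≤ 12 * ((M / B - 3 : ℕ) : ℝ) := by positivity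
  simp only [BoxedLFTJ.readBound, add_zero] at hall hnone
  set ρ : ℝ := 2 * ((3 : ℕ) : ℝ) * ((3 * G.edgeFinset.card : ℕ) : ℝ)
      / (((M / B - 3) / 9 : ℕ) * B) + 1
  set κ : ℝ := 12 * ((M / B - 3 : ℕ) : ℝ)
  set e : ℝ := (G.edgeFinset.card : ℝ)
  set K : ℝ := ((G.cliqueFinset 3).card : ℝ)
  set x : ℝ := A * (e / M)
  set μ : ℝ := (M : ℝ) / B
  have hx1 : 1 ≤ x := hρ1.trans hρ
  have hx2 : x ≤ x ^ 2 := by nlinarith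
  have hx3 : x ^ 2 ≤ x ^ 3 := by nlinarith [sq_nonneg x]
  have hKB : 3 * (K / B) ≤ 37 * A ^ 3 * (K / B) := by
    have : (3 : ℝ) ≤ 37 * A ^ 3 := by nlinarith [pow_le_pow_left₀ (by norm_num) hA 3]
    exact mul_le_mul_of_nonneg_right this (by positivity)
  refine ⟨h1, h2, BoxedLFTJ.triangleRun_peak G hB hM, ?_, fun hs => ?_⟩
  · have hr : ((BoxedLFTJ.triangleRun G M B).reads : ℝ) ≤ 36 * (x ^ 3 * μ) := by
      refine le_trans hall ?_
      calc ρ * (κ + ρ * (κ + ρ * κ))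
          ≤ x * (12 * μ + x * (12 * μ + x * (12 * μ))) := by gcongr
        _ = 12 * μ * (x + x ^ 2 + x ^ 3) := by ring
        _ ≤ 12 * μ * (3 * x ^ 3) := by gcongr; linarith
        _ = 36 * (x ^ 3 * μ) := by ring
    have hone : 1 ≤ x ^ 3 * μ := by nlinarith
    have heq : x ^ 3 * μ = A ^ 3 * (e ^ 3 / ((M : ℝ) ^ 2 * B)) := by
      simp only [x, μ]
      field_simp
    rw [mul_add, mul_assoc 37 (A ^ 3) (_ / _), ← heq]
    linarith only [hios, hr, hone, hKB]
  · have hr : ((BoxedLFTJ.triangleRun G M B).reads : ℝ) ≤ 24 * (x ^ 2 * μ) := by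
      refine le_trans (hnone hs) ?_
      calc ρ * (κ + ρ * κ)
          ≤ x * (12 * μ + x * (12 * μ)) := by gcongr
        _ = 12 * μ * (x + x ^ 2) := by ring
        _ ≤ 12 * μ * (2 * x ^ 2) := by gcongr; linarith
        _ = 24 * (x ^ 2 * μ) := by ring
    have hone : 1 ≤ x ^ 2 * μ := by nlinarith
    have heq : x ^ 2 * μ = A ^ 2 * (e ^ 2 / ((M : ℝ) * B)) := by
      simp only [x, μ]
      field_simp
    have hq : 0 ≤ e ^ 2 / ((M : ℝ) * B) := by positivity
    have hA23 : 25 * A ^ 2 ≤ 37 * A ^ 3 := by nlinarith [sq_nonneg A]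
    have := mul_le_mul_of_nonneg_right hA23 hq
    rw [mul_assoc 25, ← heq] at this
    rw [mul_add]
    linarith only [hios, hr, hone, this, hKB]
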